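/- Let $X=[0,1)^2$. A \emph{rectangle} is a non-empty set $[a_1,b_1)\times[a_2,b_2)\subseteq X$, and $\operatorname{Rec}_2$ is the group of all permutations $f$ of $X$ for which there is a finite partition of $X$ into rectangles on each of which $f$ is a translation; any such partition is said to be \emph{associated with} $f$. A finite partition $\mathcal P$ of $X$ into rectangles is \emph{setwise $\mathbf Q$-free} if for each $i\in\{1,2\}$ the set $\{\lambda(\operatorname{pr}_i(K)) : K\in\mathcal P\}$ of $i$-th side lengths is linearly independent over $\mathbf Q$ (equal lengths are counted once). Let $i\in\{1,2\}$, let $K$ and $L$ be two rectangles with the same projection $R$ to the coordinate other than the $i$-th, and whose $i$-th projections are consecutive intervals $[a,b)$ and $[b,c)$ respectively, $0\le a<b<c\le 1$. The \emph{restricted shuffle} that shuffles $K$ and $L$ is the permutation of $X$ that translates the $i$-th coordinate by $c-b$ on $K$ and by $-(b-a)$ on $L$, and is the identity outside $K\cup L$. A restricted shuffle \emph{on} a partition $\mathcal P$ of $X$ into rectangles is one that shuffles two rectangles belonging to $\mathcal P$. A \emph{sequence of restricted shuffles on} $\mathcal P$ is a finite sequence $(r_1,\dots,r_n)$, $n\ge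 0$, such that for each $1\le k\le n$ the map $r_k$ is a restricted shuffle on the partition $r_{k-1}\circ\dots\circ r_1(\mathcal P)=\{r_{k-1}\circ\dots\circ r_1(K): K\in\mathcal P\}$. \textbf{Theorem.} For every $f\in\operatorname{Rec}_2$ and every setwise $\mathbf Q$-free partition $\mathcal P$ associated with $f$, there exists a sequence $(r_1,\dots,r_n)$ of restricted shuffles on $\mathcal P$ such that $f=r_n\circ\dots\circ r_1$ (the empty composition being the identity). Moreover one can take $n\ge 1$ unless $\mathcal P=\{X\}$. -/

import Mathlib

namespace RectExchange

open MeasureTheory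

/-- The half-open unit interval `[0,1)`, as a type. -/
abbrev UnitIco : Type := Set.Ico (0 : ℝ) 1

/-- The half-open unit cube `[0,1)^ι`; the `d`-dimensional cube is `Cube (Fin d)`. -/
abbrev Cube (ι : Type) : Type := ι → UnitIco

/-- A (left half-open, non-empty) rectangle `∏ i, [a i, b i)` in the unit cube. -/
def IsRectangle {ι : Type} (K : Set (Cube ι)) : Prop :=
  ∃ a b : ι → ℝ, (∀ i, 0 ≤ a i ∧ a i < b i ∧ b i ≤ 1) ∧
    K = {x | ∀ i, a i ≤ (x i : ℝ) ∧ (x i : ℝ) < b i}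

/-- A finite partition of the unit cube into rectangles. -/
def IsRectanglePartition {ι : Type} (P : Set (Set (Cube ι))) : Prop :=
  P.Finite ∧ Setoid.IsPartition P ∧ ∀ K ∈ P, IsRectangle K

/-- The restriction of `f` to `K` is a translation. -/
def IsTranslationOn {ι : Type} (f : Equiv.Perm (Cube ι)) (K : Set (Cube ι)) : Prop :=
  ∃ v : ι → ℝ, ∀ x ∈ K, ∀ i, (f x i : ℝ) = (x i : ℝ) + v i

/-- The set `Π_f` of all finite rectangle partitions associated with `f`: the permutation `f` is a
translation on each of their pieces. -/
def associatedPartitions {ι : Type} (f : Equiv.Perm (Cube ι)) : Set (Set (Set (Cube ι))) :=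
  {P | IsRectanglePartition P ∧ ∀ K ∈ P, IsTranslationOn f K}

/-- The rectangle exchange transformations of the `d`-dimensional cube. -/
def Rec (d : ℕ) : Set (Equiv.Perm (Cube (Fin d))) :=
  {f | ∃ P, P ∈ associatedPartitions f}

/-- The image `f(P) = {f(K) | K ∈ P}`. -/
def imagePartition {ι : Type} (f : Equiv.Perm (Cube ι)) (P : Set (Set (Cube ι))) :
    Set (Set (Cube ι)) :=
  (fun K => f '' K) '' P

/-- The Lebesgue measure of the projection of `K` to the `i`-th axis. -/
noncomputable def sideLength {ι : Type} (i : ι) (K : Set (Cube ι)) : ℝ :=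
  volume.real ((fun x : Cube ι => (x i : ℝ)) '' K)

/-- For every `i`, the *set* of the `i`-th side lengths of the pieces of `P` is linearly
independent over `ℚ`. -/
def SetwiseQFree {ι : Type} (P : Set (Set (Cube ι))) : Prop :=
  ∀ i : ι, LinearIndepOn ℚ (id : ℝ → ℝ) (sideLength i '' P)

/-- The projection along the `i`-th axis, which forgets the `i`-th coordinate. -/
def prPerp {ι : Type} (i : ι) (x : Cube ι) : Cube {j : ι // j ≠ i} := fun j => x j

/-- `s` is the restricted rotation of `[0,1)` that exchanges the two consecutive intervals `[a,b)`
and `[b,c)` by translations and is the identity elsewhere. -/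
def IsRestrictedRotation (s : Equiv.Perm UnitIco) (a b c : ℝ) : Prop :=
  0 ≤ a ∧ a < b ∧ b < c ∧ c ≤ 1 ∧
    ∀ t : UnitIco,
      (a ≤ (t : ℝ) → (t : ℝ) < b → (s t : ℝ) = t + (c - b)) ∧
      (b ≤ (t : ℝ) → (t : ℝ) < c → (s t : ℝ) = t - (b - a)) ∧
      ((t : ℝ) < a ∨ c ≤ (t : ℝ) → s t = t)

/-- `σ` is the transformation `σ_{R,s,i}` that applies `s` to the `i`-th coordinate of the points
whose projection along the `i`-th axis lies in `R`, and is the identity elsewhere. -/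
def ActsByRotationOver {ι : Type} (i : ι) (R : Set (Cube {j : ι // j ≠ i}))
    (s : Equiv.Perm UnitIco) (σ : Equiv.Perm (Cube ι)) : Prop :=
  ∀ x : Cube ι,
    (prPerp i x ∉ R → σ x = x) ∧
    (prPerp i x ∈ R → (∀ j, j ≠ i → σ x j = x j) ∧ σ x i = s (x i))

/-- `σ` is a restricted shuffle (in some direction `i`) which shuffles the two rectangles `K` and
`L`: it is `σ_{R,s,i}` where `R` is a rectangle in the remaining coordinates, `s` is the restricted
rotation exchanging `[a,b)` and `[b,c)`, and `K`, `L` are the rectangles with base `R` and with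
`i`-th sides `[a,b)`, `[b,c)`. -/
def Shuffles {ι : Type} (σ : Equiv.Perm (Cube ι)) (K L : Set (Cube ι)) : Prop :=
  ∃ (i : ι) (R : Set (Cube {j : ι // j ≠ i})) (s : Equiv.Perm UnitIco) (a b c : ℝ),
    IsRectangle R ∧ IsRestrictedRotation s a b c ∧ ActsByRotationOver i R s σ ∧
    K = {x | prPerp i x ∈ R ∧ a ≤ (x i : ℝ) ∧ (x i : ℝ) < b} ∧
    L = {x | prPerp i x ∈ R ∧ b ≤ (x i : ℝ) ∧ (x i : ℝ) < c}

/-- A restricted shuffle on `P`: a restricted shuffle which shuffles two rectangles of `P`. -/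
def IsRestrictedShuffleOn {ι : Type} (P : Set (Set (Cube ι))) (σ : Equiv.Perm (Cube ι)) : Prop :=
  ∃ K ∈ P, ∃ L ∈ P, Shuffles σ K L

/-- `[r₁, …, rₙ]` is a sequence of restricted shuffles on `P`: each `rᵢ` is a restricted shuffle on
the image of `P` under `rᵢ₋₁ ∘ ⋯ ∘ r₁`. -/
def IsShuffleSequence {ι : Type} : Set (Set (Cube ι)) → List (Equiv.Perm (Cube ι)) → Prop
  | _, [] => True
  | P, r :: rs => IsRestrictedShuffleOn P r ∧ IsShuffleSequence (imagePartition r P) rs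

/-- The composition `rₙ ∘ ⋯ ∘ r₁` of `[r₁, …, rₙ]` (the identity for the empty list). -/
def composeSequence {ι : Type} : List (Equiv.Perm (Cube ι)) → Equiv.Perm (Cube ι)
  | [] => 1
  | r :: rs => composeSequence rs * r

end RectExchange

set_option linter.unusedSectionVars false

namespace RectExchange

/-! A piece of `P` is treated as a label with fixed side lengths `l` and a movable lowest corner
`p`. As `f` translates every piece, `P` and its image are two tilings of the square by the same
labelled tiles. The theorem follows once exchanges of adjacent tiles with a full common side connect
any two such tilings (`Tiles.reach_tiles`), because each exchange is a restricted shuffle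
(`Follows.exists_shuffle`).

Freeness enters through counting. For each side length there is an additive map `ℝ →+ ℝ` equal to 1
there and to 0 at the other lengths of that direction. Summed along a line across a box, it counts
the tiles of that length, and the total depends only on the interval filled. So all parallel lines
meet equally many tiles of each length.

The core is `Tiles.exists_bottom_row`: tiles of a given height that occurs can be brought together
into a bottom row. The lowest tiles of that height in their columns form a band that meets each
column once. In a maximal run of the band at its highest level, counting shows that the tiles
directly beneath do not stick out sideways. Run and underside thus fill the same interval, so some
tile of the run is as wide as the leftmost tile beneath. It is moved above that tile and exchanged
with it, which lowers the band.

Peeling off equal rows makes two tilings agree up to congruent tiles (`exists_match`), and congruent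
tiles can be interchanged (`Tiles.swappable`). -/

/-! ### Stacks of intervals -/

/-- The intervals `[pos t, pos t + len t)`, `t ∈ F`, tile `[a, b)`. -/
structure IsStack {T : Type} (F : Finset T) (pos len : T → ℝ) (a b : ℝ) : Prop where
  lo_le : ∀ t ∈ F, a ≤ pos t
  le_hi : ∀ t ∈ F, pos t + len t ≤ b
  exists_mem : ∀ y, a ≤ y → y < b → ∃ t ∈ F, pos t ≤ y ∧ y < pos t + len t
  unique : ∀ t ∈ F, ∀ s ∈ F, ∀ y, pos t ≤ y → y < pos t + len t →
    pos s ≤ y → y < pos s + len s → t = s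

namespace IsStack

variable {T : Type} {F : Finset T} {pos len : T → ℝ} {a b : ℝ}

/-- Additivity of Lebesgue measure gives this without ordering the members. -/
theorem sum_len (h : IsStack F pos len a b) (hab : a ≤ b) (hlen : ∀ t, 0 < len t) :
    ∑ t ∈ F, len t = b - a := by
  have hU : (⋃ t ∈ F, Set.Ico (pos t) (pos t + len t)) = Set.Ico a b := by
    ext y
    simp only [Set.mem_iUnion, Set.mem_Ico, exists_prop]
    constructor
    · rintro ⟨t, ht, h1, h2⟩
      exact ⟨(h.lo_le t ht).trans h1, h2.trans_le (h.le_hi t ht)⟩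
    · rintro ⟨h1, h2⟩
      exact h.exists_mem y h1 h2
  have hd : Set.PairwiseDisjoint (F : Set T) (fun t => Set.Ico (pos t) (pos t + len t)) := by
    intro t ht s hs hts
    refine Set.disjoint_left.2 fun y h1 h2 => hts ?_
    exact h.unique t ht s hs y h1.1 h1.2 h2.1 h2.2
  have hm := MeasureTheory.measureReal_biUnion_finset (μ := MeasureTheory.volume) hd
    (fun t _ => measurableSet_Ico) (fun t _ => by simp)
  rw [hU] at hm
  simp only [Real.volume_real_Ico, add_sub_cancel_left] at hm
  rw [max_eq_left (by linarith)] at hm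
  rw [hm]
  exact Finset.sum_congr rfl fun t _ => (max_eq_left (hlen t).le).symm

/-- The source of all counting: if `φ` is 1 at one length and 0 at the others, the sum is the number
of members of that length, and it depends only on `b - a`. -/
theorem sum_map (h : IsStack F pos len a b) (hab : a ≤ b) (hlen : ∀ t, 0 < len t)
    (φ : ℝ →+ ℝ) : ∑ t ∈ F, φ (len t) = φ (b - a) := by
  rw [← h.sum_len hab hlen, map_sum]

/-- Two members of a stack are comparable. -/
theorem le_or_le (h : IsStack F pos len a b) (hlen : ∀ t, 0 < len t) {t s : T} (ht : t ∈ F)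
    (hs : s ∈ F) (hts : t ≠ s) : pos t + len t ≤ pos s ∨ pos s + len s ≤ pos t := by
  by_contra! hc
  rcases le_total (pos t) (pos s) with h1 | h1
  · exact hts (h.unique t ht s hs (pos s) h1 hc.1 le_rfl (by linarith [hlen s]))
  · exact hts (h.unique t ht s hs (pos t) le_rfl (by linarith [hlen t]) h1 hc.2)

/-- The part of a stack between two bounds that no member crosses. -/
theorem between [DecidableEq T] (h : IsStack F pos len a b) {a' b' : ℝ} (ha : a ≤ a') (hb : b' ≤ b)
    (ha' : ∀ t ∈ F, pos t + len t ≤ a' ∨ a' ≤ pos t)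
    (hb' : ∀ t ∈ F, pos t + len t ≤ b' ∨ b' ≤ pos t) :
    IsStack {t ∈ F | a' ≤ pos t ∧ pos t + len t ≤ b'} pos len a' b' where
  lo_le t ht := (Finset.mem_filter.1 ht).2.1
  le_hi t ht := (Finset.mem_filter.1 ht).2.2
  exists_mem y h1 h2 := by
    obtain ⟨t, ht, h3, h4⟩ := h.exists_mem y (ha.trans h1) (h2.trans_le hb)
    refine ⟨t, Finset.mem_filter.2 ⟨ht, ?_, ?_⟩, h3, h4⟩
    · exact (ha' t ht).resolve_left (by linarith)
    · exact (hb' t ht).resolve_right (by linarith)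
  unique t ht s hs := h.unique t (Finset.mem_filter.1 ht).1 s (Finset.mem_filter.1 hs).1

/-- For a counting `φ`, the position of `u` alone reveals how many members of the chosen length
precede it. -/
theorem sum_below [DecidableEq T] (h : IsStack F pos len a b) (hlen : ∀ t, 0 < len t)
    (φ : ℝ →+ ℝ) {u : T} (hu : u ∈ F) :
    ∑ t ∈ F with pos t + len t ≤ pos u, φ (len t) = φ (pos u - a) := by
  have h1 := h.between le_rfl (b' := pos u) (by linarith [h.le_hi u hu, hlen u])
    (fun t ht => Or.inr (h.lo_le t ht)) (fun t ht => by
      rcases eq_or_ne t u with rfl | htu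
      · exact Or.inr le_rfl
      · exact (h.le_or_le hlen ht hu htu).imp_right fun h => by linarith [hlen u])
  rw [← h1.sum_map (h.lo_le u hu) hlen φ]
  refine Finset.sum_congr (Finset.filter_congr fun t ht => ?_) fun _ _ => rfl
  simp [h.lo_le t ht]

theorem map_pos_nonneg [DecidableEq T] (h : IsStack F pos len a b) (hlen : ∀ t, 0 < len t)
    {φ : ℝ →+ ℝ} (hφ : ∀ t, 0 ≤ φ (len t)) {u : T} (hu : u ∈ F) : 0 ≤ φ (pos u - a) := by
  rw [← h.sum_below hlen φ hu]
  exact Finset.sum_nonneg fun t _ => hφ t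

theorem map_pos_add_le [DecidableEq T] (h : IsStack F pos len a b) (hlen : ∀ t, 0 < len t)
    {φ : ℝ →+ ℝ} (hφ : ∀ t, 0 ≤ φ (len t)) {t u : T} (ht : t ∈ F) (hu : u ∈ F)
    (htu : pos t + len t ≤ pos u) : φ (pos t - a) + φ (len t) ≤ φ (pos u - a) := by
  rw [← h.sum_below hlen φ hu, ← h.sum_below hlen φ ht, add_comm, ← Finset.sum_insert
    (s := {s ∈ F | pos s + len s ≤ pos t}) (f := fun s => φ (len s)) (by simp [hlen t])]
  refine Finset.sum_le_sum_of_subset_of_nonneg (fun s hs => ?_) fun s _ _ => hφ s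
  rcases Finset.mem_insert.1 hs with rfl | hs
  · exact Finset.mem_filter.2 ⟨ht, htu⟩
  · have := Finset.mem_filter.1 hs
    exact Finset.mem_filter.2 ⟨this.1, by linarith [hlen t]⟩

/-- Immediately below every member that is not the first there is another one. -/
theorem exists_below [DecidableEq T] (h : IsStack F pos len a b) (hlen : ∀ t, 0 < len t) {u : T}
    (hu : u ∈ F) (hau : a < pos u) : ∃ t ∈ F, pos t + len t = pos u := by
  -- `m` will be the largest end of a member below `u`, with `a` as default. If `m < pos u`, the
  -- member covering `m` would end higher and still lie below `u`.
  have hne : (insert a ((F.filter fun t => pos t + len t ≤ pos u).image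
      fun t => pos t + len t)).Nonempty := Finset.insert_nonempty _ _
  obtain ⟨m, hm, hmax⟩ := Finset.exists_max_image _ id hne
  simp only [id] at hmax
  have ham : a ≤ m := hmax a (Finset.mem_insert_self _ _)
  have hmu : m ≤ pos u := by
    rcases Finset.mem_insert.1 hm with rfl | hm
    · exact hau.le
    · obtain ⟨t, ht, rfl⟩ := Finset.mem_image.1 hm
      exact (Finset.mem_filter.1 ht).2
  have hmu' : m = pos u := by
    refine hmu.antisymm (le_of_not_gt fun hlt => ?_)
    obtain ⟨t, ht, h1, h2⟩ := h.exists_mem m ham (by linarith [h.le_hi u hu, hlen u])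
    have htu : t ≠ u := by rintro rfl; linarith
    rcases h.le_or_le hlen ht hu htu with h3 | h3
    · have := hmax _ (Finset.mem_insert_of_mem (Finset.mem_image_of_mem _
        (Finset.mem_filter.2 ⟨ht, h3⟩)))
      linarith
    · linarith [hlen u]
  rcases Finset.mem_insert.1 hm with h1 | hm
  · linarith
  · obtain ⟨t, ht, h1⟩ := Finset.mem_image.1 hm
    exact ⟨t, (Finset.mem_filter.1 ht).1, by linarith⟩

end IsStack

/-! ### Labelled tilings and exchanges of adjacent tiles -/

section Config

variable {T ι : Type}

/-- The point `q` lies in the tile of sizes `l t` with lowest corner `p t`. -/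
def Covers (l p : T → ι → ℝ) (t : T) (q : ι → ℝ) : Prop :=
  ∀ i, p t i ≤ q i ∧ q i < p t i + l t i

/-- The tiles labelled by `S` tile the box `∏ i, [lo i, hi i)`. -/
structure Tiles (l p : T → ι → ℝ) (S : Finset T) (lo hi : ι → ℝ) : Prop where
  lo_le : ∀ t ∈ S, ∀ i, lo i ≤ p t i
  le_hi : ∀ t ∈ S, ∀ i, p t i + l t i ≤ hi i
  exists_mem : ∀ q : ι → ℝ, (∀ i, lo i ≤ q i ∧ q i < hi i) → ∃ t ∈ S, Covers l p t q
  unique : ∀ t ∈ S, ∀ s ∈ S, ∀ q, Covers l p t q → Covers l p s q → t = s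

/-- The tile `t` follows `s` in direction `i`, and they share a full side. -/
def Follows (l p : T → ι → ℝ) (i : ι) (s t : T) : Prop :=
  p t i = p s i + l s i ∧ ∀ j, j ≠ i → p t j = p s j ∧ l t j = l s j

open Classical in
/-- The positions after exchanging `s` with the tile `t` following it in direction `i`. -/
noncomputable def exchange (l p : T → ι → ℝ) (i : ι) (s t : T) : T → ι → ℝ := fun u j =>
  if j = i then (if u = s then p s i + l t i else if u = t then p s i else p u i) else p u j

/-- One exchange of two adjacent tiles labelled by `S`. -/
def Step (l : T → ι → ℝ) (S : Finset T) (p p' : T → ι → ℝ) : Prop :=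
  ∃ i, ∃ s ∈ S, ∃ t ∈ S, Follows l p i s t ∧ p' = exchange l p i s t

/-- Finitely many exchanges of tiles labelled by `S`. -/
abbrev Reach (l : T → ι → ℝ) (S : Finset T) : (T → ι → ℝ) → (T → ι → ℝ) → Prop :=
  Relation.ReflTransGen (Step l S)

variable {l p p' : T → ι → ℝ} {S R : Finset T} {lo hi : ι → ℝ}

theorem Follows.ne (hl : ∀ t i, 0 < l t i) {i : ι} {s t : T} (h : Follows l p i s t) : s ≠ t := by
  rintro rfl
  have := h.1
  linarith [hl s i]

theorem exchange_of_ne (i : ι) {s t u : T} (hs : u ≠ s) (ht : u ≠ t) :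
    exchange l p i s t u = p u := by
  ext j
  by_cases hj : j = i
  · subst hj; simp [exchange, hs, ht]
  · simp [exchange, hj]

theorem exchange_of_ne_dir {i j : ι} (hj : j ≠ i) (s t u : T) :
    exchange l p i s t u j = p u j := by
  simp [exchange, hj]

theorem exchange_left (i : ι) (s t : T) : exchange l p i s t s i = p s i + l t i := by
  simp [exchange]

theorem exchange_right (i : ι) {s t : T} (h : s ≠ t) : exchange l p i s t t i = p s i := by
  simp [exchange, h.symm]

theorem Follows.reverse (hl : ∀ t i, 0 < l t i) {i : ι} {s t : T} (h : Follows l p i s t) :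
    Follows l (exchange l p i s t) i t s := by
  refine ⟨?_, fun j hj => ?_⟩
  · rw [exchange_left, exchange_right i (h.ne hl)]
  · rw [exchange_of_ne_dir hj, exchange_of_ne_dir hj]
    exact ⟨(h.2 j hj).1.symm, (h.2 j hj).2.symm⟩

theorem Follows.exchange_exchange (hl : ∀ t i, 0 < l t i) {i : ι} {s t : T}
    (h : Follows l p i s t) :
    exchange l (exchange l p i s t) i t s = p := by
  have hne := h.ne hl
  ext u j
  by_cases hj : j = i
  · subst hj
    have := h.1
    by_cases hs : u = s
    · subst hs; simp [exchange, hne, hne.symm]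
    · by_cases ht : u = t
      · subst ht; simp [exchange, hne.symm]; linarith
      · simp [exchange, hs, ht]
  · simp [exchange, hj]

theorem Step.symm (hl : ∀ t i, 0 < l t i) (h : Step l S p p') : Step l S p' p := by
  obtain ⟨i, s, hs, t, ht, hf, rfl⟩ := h
  exact ⟨i, t, ht, s, hs, hf.reverse hl, (hf.exchange_exchange hl).symm⟩

theorem Step.mono (hRS : R ⊆ S) (h : Step l R p p') : Step l S p p' := by
  obtain ⟨i, s, hs, t, ht, hf, rfl⟩ := h
  exact ⟨i, s, hRS hs, t, hRS ht, hf, rfl⟩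

theorem Step.eq_of_notMem (h : Step l S p p') {u : T} (hu : u ∉ S) : p' u = p u := by
  obtain ⟨i, s, hs, t, ht, hf, rfl⟩ := h
  exact exchange_of_ne i (by rintro rfl; exact hu hs) (by rintro rfl; exact hu ht)

theorem Reach.symm (hl : ∀ t i, 0 < l t i) (h : Reach l S p p') : Reach l S p' p := by
  induction h with
  | refl => exact .refl
  | tail _ h ih => exact (Relation.ReflTransGen.single (h.symm hl)).trans ih

theorem Reach.mono (hRS : R ⊆ S) (h : Reach l R p p') : Reach l S p p' :=
  Relation.ReflTransGen.mono (fun _ _ => Step.mono hRS) _ _ h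

theorem Reach.eq_of_notMem (h : Reach l S p p') {u : T} (hu : u ∉ S) : p' u = p u := by
  induction h with
  | refl => rfl
  | tail _ h ih => rw [h.eq_of_notMem hu, ih]

theorem Tiles.congr (h : Tiles l p S lo hi) (hp : ∀ t ∈ S, p' t = p t) : Tiles l p' S lo hi where
  lo_le t ht := by rw [hp t ht]; exact h.lo_le t ht
  le_hi t ht := by rw [hp t ht]; exact h.le_hi t ht
  exists_mem q hq := by
    obtain ⟨t, ht, hc⟩ := h.exists_mem q hq
    exact ⟨t, ht, by unfold Covers; rw [hp t ht]; exact hc⟩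
  unique t ht s hs q h1 h2 := by
    unfold Covers at h1 h2
    rw [hp t ht] at h1
    rw [hp s hs] at h2
    exact h.unique t ht s hs q h1 h2

/-- A point of one of two adjacent tiles lies in exactly one of the exchanged tiles. -/
theorem Follows.covers_exchange (hl : ∀ t i, 0 < l t i) {i : ι} {s t : T} (h : Follows l p i s t)
    {q : ι → ℝ} (hq : Covers l p s q ∨ Covers l p t q) :
    Covers l (exchange l p i s t) s q ∨
      Covers l (exchange l p i s t) t q := by
  have hne := h.ne hl
  have h1 := h.1
  have key : (∀ j, j ≠ i → p s j ≤ q j ∧ q j < p s j + l s j) ∧ p s i ≤ q i ∧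
      q i < p s i + l s i + l t i := by
    rcases hq with hq | hq
    · exact ⟨fun j _ => hq j, (hq i).1, by linarith [(hq i).2, hl t i]⟩
    · refine ⟨fun j hj => ?_, by linarith [(hq i).1, hl s i], by linarith [(hq i).2]⟩
      rw [← (h.2 j hj).1, ← (h.2 j hj).2]
      exact hq j
  rcases lt_or_ge (q i) (p s i + l t i) with hlt | hge
  · right
    intro j
    by_cases hj : j = i
    · subst hj
      rw [exchange_right _ hne]
      exact ⟨key.2.1, hlt⟩
    · rw [exchange_of_ne_dir hj, (h.2 j hj).1, (h.2 j hj).2]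
      exact key.1 j hj
  · left
    intro j
    by_cases hj : j = i
    · subst hj
      rw [exchange_left]
      exact ⟨hge, by linarith⟩
    · rw [exchange_of_ne_dir hj]
      exact key.1 j hj

theorem Follows.covers_of_exchange (hl : ∀ t i, 0 < l t i) {i : ι} {s t : T}
    (h : Follows l p i s t) {q : ι → ℝ}
    (hq : Covers l (exchange l p i s t) s q ∨
      Covers l (exchange l p i s t) t q) : Covers l p s q ∨ Covers l p t q := by
  have := (h.reverse hl).covers_exchange hl hq.symm
  rw [h.exchange_exchange hl] at this
  exact this.symm

theorem Follows.not_covers_both {i : ι} {s t : T} (h : Follows l p i s t)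
    {q : ι → ℝ} (hs : Covers l p s q) (ht : Covers l p t q) : False := by
  have := h.1
  linarith [(hs i).2, (ht i).1]

theorem Tiles.step (hl : ∀ t i, 0 < l t i) (h : Tiles l p S lo hi) (hs : Step l S p p') :
    Tiles l p' S lo hi := by
  obtain ⟨i, s, hs, t, ht, hf, rfl⟩ := hs
  have hne := hf.ne hl
  have h1 := hf.1
  have hcov : ∀ u q, u ≠ s → u ≠ t → (Covers l (exchange l p i s t) u q ↔ Covers l p u q) := by
    intro u q h1 h2
    unfold Covers
    rw [exchange_of_ne i h1 h2]
  refine ⟨fun u hu j => ?_, fun u hu j => ?_, fun q hq => ?_, fun u hu v hv q huq hvq => ?_⟩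
  · by_cases hj : j = i
    · subst hj
      by_cases hus : u = s
      · subst hus; rw [exchange_left]; linarith [h.lo_le u hu j, hl t j]
      · by_cases hut : u = t
        · subst hut; rw [exchange_right _ hne]; exact h.lo_le s hs j
        · rw [exchange_of_ne _ hus hut]; exact h.lo_le u hu j
    · rw [exchange_of_ne_dir hj]; exact h.lo_le u hu j
  · by_cases hj : j = i
    · subst hj
      by_cases hus : u = s
      · subst hus; rw [exchange_left]; linarith [h.le_hi t ht j]
      · by_cases hut : u = t
        · subst hut; rw [exchange_right _ hne]; linarith [h.le_hi u ht j, hl s j]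
        · rw [exchange_of_ne _ hus hut]; exact h.le_hi u hu j
    · rw [exchange_of_ne_dir hj]; exact h.le_hi u hu j
  · obtain ⟨u, hu, hc⟩ := h.exists_mem q hq
    by_cases hst : u = s ∨ u = t
    · have : Covers l p s q ∨ Covers l p t q := by
        rcases hst with rfl | rfl
        · exact Or.inl hc
        · exact Or.inr hc
      rcases hf.covers_exchange hl this with h2 | h2
      · exact ⟨s, hs, h2⟩
      · exact ⟨t, ht, h2⟩
    · push Not at hst
      exact ⟨u, hu, (hcov u q hst.1 hst.2).2 hc⟩
  · have hold : ∀ w, w = s ∨ w = t → Covers l (exchange l p i s t) w q →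
        Covers l p s q ∨ Covers l p t q := by
      rintro w (rfl | rfl) hw
      · exact hf.covers_of_exchange hl (Or.inl hw)
      · exact hf.covers_of_exchange hl (Or.inr hw)
    -- The exchange preserves the union of `s` and `t`, so an unmoved tile that meets it afterwards
    -- already met `s` or `t` before.
    have hmix : ∀ w z, w = s ∨ w = t → z ≠ s → z ≠ t → z ∈ S →
        Covers l (exchange l p i s t) w q → Covers l (exchange l p i s t) z q → False := by
      intro w z hw hzs hzt hz hwq hzq
      rw [hcov z q hzs hzt] at hzq
      rcases hold w hw hwq with h3 | h3
      · exact hzs (h.unique z hz s hs q hzq h3)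
      · exact hzt (h.unique z hz t ht q hzq h3)
    by_cases hu' : u = s ∨ u = t
    · by_cases hv' : v = s ∨ v = t
      · rcases hu' with rfl | rfl <;> rcases hv' with rfl | rfl
        · rfl
        · exact ((hf.reverse hl).not_covers_both hvq huq).elim
        · exact ((hf.reverse hl).not_covers_both huq hvq).elim
        · rfl
      · push Not at hv'
        exact (hmix u v hu' hv'.1 hv'.2 hv huq hvq).elim
    · push Not at hu'
      by_cases hv' : v = s ∨ v = t
      · exact (hmix v u hv' hu'.1 hu'.2 hu hvq huq).elim
      · push Not at hv'
        rw [hcov u q hu'.1 hu'.2] at huq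
        rw [hcov v q hv'.1 hv'.2] at hvq
        exact h.unique u hu v hv q huq hvq

theorem Tiles.reach (hl : ∀ t i, 0 < l t i) (h : Tiles l p S lo hi) (hs : Reach l S p p') :
    Tiles l p' S lo hi := by
  induction hs with
  | refl => exact h
  | tail _ hs ih => exact ih.step hl hs

/-- The part of a tiling below a hyperplane that no tile crosses. -/
theorem Tiles.cut_below [DecidableEq ι] (h : Tiles l p S lo hi)
    (hRS : R ⊆ S) {i : ι} {c : ℝ} (hc : c ≤ hi i) (hR : ∀ t ∈ R, p t i + l t i ≤ c)
    (hR' : ∀ t ∈ S, t ∉ R → c ≤ p t i) : Tiles l p R lo (Function.update hi i c) where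
  lo_le t ht := h.lo_le t (hRS ht)
  le_hi t ht j := by
    by_cases hj : j = i
    · subst hj; simpa using hR t ht
    · simpa [hj] using h.le_hi t (hRS ht) j
  exists_mem q hq := by
    have hqi : q i < c := by simpa using (hq i).2
    obtain ⟨t, ht, hcov⟩ := h.exists_mem q fun j => by
      by_cases hj : j = i
      · subst hj; exact ⟨(hq j).1, hqi.trans_le hc⟩
      · simpa [hj] using hq j
    refine ⟨t, ?_, hcov⟩
    by_contra htR
    linarith [hR' t ht htR, (hcov i).1]
  unique t ht s hs := h.unique t (hRS ht) s (hRS hs)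

/-- The part of a tiling above a hyperplane that no tile crosses. -/
theorem Tiles.cut_above [DecidableEq ι] [DecidableEq T] (h : Tiles l p S lo hi)
    {i : ι} {c : ℝ} (hc : lo i ≤ c) (hR : ∀ t ∈ R, p t i + l t i ≤ c)
    (hR' : ∀ t ∈ S, t ∉ R → c ≤ p t i) : Tiles l p (S \ R) (Function.update lo i c) hi where
  lo_le t ht j := by
    have ht' := Finset.mem_sdiff.1 ht
    by_cases hj : j = i
    · subst hj; simpa using hR' t ht'.1 ht'.2
    · simpa [hj] using h.lo_le t ht'.1 j
  le_hi t ht := h.le_hi t (Finset.mem_sdiff.1 ht).1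
  exists_mem q hq := by
    have hqi : c ≤ q i := by simpa using (hq i).1
    obtain ⟨t, ht, hcov⟩ := h.exists_mem q fun j => by
      by_cases hj : j = i
      · subst hj; exact ⟨hc.trans hqi, (hq j).2⟩
      · simpa [hj] using hq j
    refine ⟨t, Finset.mem_sdiff.2 ⟨ht, fun htR => ?_⟩, hcov⟩
    linarith [hR t htR, (hcov i).2]
  unique t ht s hs := h.unique t (Finset.mem_sdiff.1 ht).1 s (Finset.mem_sdiff.1 hs).1

end Config

/-! ### Lines across planar tilings -/

section Plane

variable {T : Type} [DecidableEq T] {l p p' : T → Fin 2 → ℝ} {S R : Finset T}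

/-- For every side length occurring in direction `i` some additive function takes the value `1` at
that length and vanishes at the other lengths. -/
def Free (l : T → Fin 2 → ℝ) : Prop :=
  ∀ i t₀, ∃ φ : ℝ →+ ℝ, ∀ t, φ (l t i) = if l t i = l t₀ i then 1 else 0

/-- The tiles that meet the line on which the coordinate `k` equals `z`. -/
noncomputable def line (l p : T → Fin 2 → ℝ) (S : Finset T) (k : Fin 2) (z : ℝ) : Finset T :=
  {t ∈ S | p t k ≤ z ∧ z < p t k + l t k}

theorem mem_line {k : Fin 2} {z : ℝ} {t : T} :
    t ∈ line l p S k z ↔ t ∈ S ∧ p t k ≤ z ∧ z < p t k + l t k := Finset.mem_filter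

theorem Tiles.isStack_line {lo hi : Fin 2 → ℝ} (h : Tiles l p S lo hi) {i k : Fin 2} (hik : i ≠ k)
    {z : ℝ} (hz : lo k ≤ z) (hz' : z < hi k) :
    IsStack (line l p S k z) (fun t => p t i) (fun t => l t i) (lo i) (hi i) := by
  have hj : ∀ j : Fin 2, j = i ∨ j = k := by omega
  refine ⟨fun t ht => h.lo_le t (mem_line.1 ht).1 i, fun t ht => h.le_hi t (mem_line.1 ht).1 i,
    fun y h1 h2 => ?_, fun t ht s hs y h1 h2 h3 h4 => ?_⟩
  · obtain ⟨t, ht, hc⟩ := h.exists_mem (fun j => if j = i then y else z) (fun j => by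
      rcases hj j with rfl | rfl
      · simp [h1, h2]
      · simp [hik.symm, hz, hz'])
    have hi := hc i
    have hk := hc k
    simp only [if_true, hik.symm, if_false] at hi hk
    exact ⟨t, mem_line.2 ⟨ht, hk⟩, hi⟩
  · have ht := mem_line.1 ht
    have hs := mem_line.1 hs
    refine h.unique t ht.1 s hs.1 (fun j => if j = i then y else z) (fun j => ?_) (fun j => ?_)
    · rcases hj j with rfl | rfl
      · simp [h1, h2]
      · simp [hik.symm, ht.2]
    · rcases hj j with rfl | rfl
      · simp [h3, h4]
      · simp [hik.symm, hs.2]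

/-- Makes a run inside a larger tiling a tiling of its own box, so that the results on rows apply to
it. -/
theorem IsStack.tiles {a b y h : ℝ} (hR : IsStack R (fun t => p t 0) (fun t => l t 0) a b)
    (hy : ∀ t ∈ R, p t 1 = y ∧ l t 1 = h) : Tiles l p R ![a, y] ![b, y + h] := by
  refine ⟨fun t ht i => ?_, fun t ht i => ?_, fun q hq => ?_, fun t ht s hs q h1 h2 => ?_⟩
  · fin_cases i
    · exact hR.lo_le t ht
    · exact (hy t ht).1.ge
  · fin_cases i
    · exact hR.le_hi t ht
    · simp [(hy t ht).1, (hy t ht).2]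
  · obtain ⟨t, ht, h1⟩ := hR.exists_mem (q 0) (hq 0).1 (hq 0).2
    refine ⟨t, ht, Fin.forall_fin_two.2 ⟨h1, ?_⟩⟩
    rw [(hy t ht).1, (hy t ht).2]
    exact hq 1
  · exact hR.unique t ht s hs (q 0) (h1 0).1 (h1 0).2 (h2 0).1 (h2 0).2

/-! ### Rows -/

variable {x0 y0 x1 y1 : ℝ}

theorem Tiles.row_pos (h : Tiles l p R ![x0, y0] ![x1, y1]) (hR : ∀ t ∈ R, l t 1 = y1 - y0) {t : T}
    (ht : t ∈ R) : p t 1 = y0 := by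
  have h1 := h.lo_le t ht 1
  have h2 := h.le_hi t ht 1
  simp only [Matrix.cons_val_one, Matrix.cons_val_fin_one] at h1 h2
  linarith [hR t ht]

theorem Tiles.row_isStack (h : Tiles l p R ![x0, y0] ![x1, y1])
    (hR : ∀ t ∈ R, l t 1 = y1 - y0) (hy : y0 < y1) :
    IsStack R (fun t => p t 0) (fun t => l t 0) x0 x1 := by
  have h1 := h.isStack_line (i := 0) (k := 1) (by decide) (z := y0) (by simp) (by simpa using hy)
  have h2 : line l p R 1 y0 = R := by
    refine Finset.filter_true_of_mem fun t ht => ?_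
    rw [h.row_pos hR ht, hR t ht]
    constructor <;> linarith
  rw [h2] at h1
  exact h1

/-- Neighbours in a row share a full side, so `A` can be exchanged with its left neighbour until no
tile is left of it. -/
theorem exists_reach_front (hl : ∀ t i, 0 < l t i) (h : Tiles l p R ![x0, y0] ![x1, y1])
    (hR : ∀ t ∈ R, l t 1 = y1 - y0) {A : T} (hA : A ∈ R) :
    ∃ p', Reach l R p p' ∧ p' A 0 = x0 := by
  obtain ⟨n, hn⟩ : ∃ n, ({t ∈ R | p t 0 < p A 0}).card = n := ⟨_, rfl⟩
  induction n using Nat.strong_induction_on generalizing p with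
  | _ n ih =>
    have hy : y0 < y1 := by linarith [hl A 1, hR A hA]
    have hst := h.row_isStack hR hy
    rcases (hst.lo_le A hA).eq_or_lt with h0 | h0
    · exact ⟨p, .refl, h0.symm⟩
    obtain ⟨s, hs, hsA⟩ := hst.exists_below (fun t => hl t 0) hA h0
    have hF : Follows l p 0 s A := by
      refine ⟨hsA.symm, fun j hj => ?_⟩
      obtain rfl : j = 1 := by omega
      rw [h.row_pos hR hs, h.row_pos hR hA, hR s hs, hR A hA]
      exact ⟨rfl, rfl⟩
    have hne := hF.ne hl
    have hstep : Step l R p (exchange l p 0 s A) := ⟨0, s, hs, A, hA, hF, rfl⟩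
    obtain ⟨p', hp', hp'A⟩ := ih _ (by
      rw [← hn]
      refine Finset.card_lt_card (Finset.ssubset_iff_of_subset ?_ |>.2 ⟨s, ?_, ?_⟩)
      · intro t ht
        have ht' := Finset.mem_filter.1 ht
        rw [exchange_right _ hne] at ht'
        refine Finset.mem_filter.2 ⟨ht'.1, ?_⟩
        by_cases hts : t = s
        · subst hts; linarith [hl t 0]
        · by_cases htA : t = A
          · subst htA; have := ht'.2; rw [exchange_right _ hne] at this; linarith
          · have := ht'.2
            rw [exchange_of_ne _ hts htA] at this
            linarith [hl s 0]
      · exact Finset.mem_filter.2 ⟨hs, by linarith [hl s 0]⟩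
      · intro hc
        have := (Finset.mem_filter.1 hc).2
        rw [exchange_right _ hne, exchange_left] at this
        linarith [hl A 0]) (h.step hl hstep) rfl
    exact ⟨p', (Relation.ReflTransGen.single hstep).trans hp', hp'A⟩

/-- Side lengths occur equally often in two stacks on the same interval. -/
theorem IsStack.exists_len_eq {F F' : Finset T} {pos pos' len : T → ℝ} {a b : ℝ} {t₀ : T}
    {φ : ℝ →+ ℝ} (hφ : ∀ t, φ (len t) = if len t = len t₀ then 1 else 0)
    (h : IsStack F pos len a b) (h' : IsStack F' pos' len a b) (hab : a ≤ b)
    (hlen : ∀ t, 0 < len t) (ht : t₀ ∈ F) : ∃ t ∈ F', len t = len t₀ := by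
  by_contra! hc
  have h1 := h.sum_map hab hlen φ
  rw [← h'.sum_map hab hlen φ, Finset.sum_eq_zero (s := F') fun t ht => by
    rw [hφ, if_neg (hc t ht)]] at h1
  have := (Finset.sum_eq_zero_iff_of_nonneg fun t _ => by rw [hφ]; split_ifs <;> simp).1 h1 t₀ ht
  rw [hφ] at this
  simp at this

/-! ### The lowest tiles of a given height -/

/-- The tiles of height `η` below which, in their columns, there is no tile of height `η`. -/
noncomputable def band (l p : T → Fin 2 → ℝ) (S : Finset T) (φ : ℝ →+ ℝ) (η y0 : ℝ) : Finset T :=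
  {t ∈ S | l t 1 = η ∧ φ (p t 1 - y0) = 0}

theorem mem_band {φ : ℝ →+ ℝ} {η : ℝ} {t : T} :
    t ∈ band l p S φ η y0 ↔ t ∈ S ∧ l t 1 = η ∧ φ (p t 1 - y0) = 0 := Finset.mem_filter

section Band

variable {φ : ℝ →+ ℝ} {η : ℝ}

theorem Tiles.isStack_column (h : Tiles l p S ![x0, y0] ![x1, y1]) {x : ℝ} (hx : x0 ≤ x)
    (hx' : x < x1) : IsStack (line l p S 0 x) (fun t => p t 1) (fun t => l t 1) y0 y1 :=
  h.isStack_line (i := 1) (k := 0) (by decide) hx hx'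

theorem Tiles.bounds (h : Tiles l p S ![x0, y0] ![x1, y1]) {t : T} (ht : t ∈ S) {x : ℝ}
    (hx : p t 0 ≤ x ∧ x < p t 0 + l t 0) : x0 ≤ x ∧ x < x1 :=
  ⟨(h.lo_le t ht 0).trans hx.1, hx.2.trans_le (h.le_hi t ht 0)⟩

variable (hl : ∀ t i, 0 < l t i) (hφ : ∀ t, φ (l t 1) = if l t 1 = η then 1 else 0)
  (h : Tiles l p S ![x0, y0] ![x1, y1])
include hl hφ h

/-- If one lay below the other in a common column, the count below the upper one would be at least 1
instead of 0. -/
theorem Tiles.band_unique {U V : T} (hU : U ∈ band l p S φ η y0) (hV : V ∈ band l p S φ η y0)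
    {x : ℝ} (hxU : p U 0 ≤ x ∧ x < p U 0 + l U 0) (hxV : p V 0 ≤ x ∧ x < p V 0 + l V 0) :
    U = V := by
  have hU' := mem_band.1 hU
  have hV' := mem_band.1 hV
  have hb := h.bounds hU'.1 hxU
  have hst := h.isStack_column hb.1 hb.2
  have hφ0 : ∀ t, 0 ≤ φ (l t 1) := fun t => by rw [hφ]; split_ifs <;> simp
  by_contra hne
  rcases hst.le_or_le (fun t => hl t 1) (mem_line.2 ⟨hU'.1, hxU⟩) (mem_line.2 ⟨hV'.1, hxV⟩) hne
    with h1 | h1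
  · have := hst.map_pos_add_le (fun t => hl t 1) hφ0 (mem_line.2 ⟨hU'.1, hxU⟩)
      (mem_line.2 ⟨hV'.1, hxV⟩) h1
    rw [hU'.2.2, hV'.2.2, hφ, if_pos hU'.2.1] at this
    linarith
  · have := hst.map_pos_add_le (fun t => hl t 1) hφ0 (mem_line.2 ⟨hV'.1, hxV⟩)
      (mem_line.2 ⟨hU'.1, hxU⟩) h1
    rw [hU'.2.2, hV'.2.2, hφ, if_pos hV'.2.1] at this
    linarith

/-- The height `η` occurs in the column of `t₀`, hence by counting in every column; the lowest tile
of this height there belongs to the band. -/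
theorem Tiles.band_exists {t₀ : T} (ht₀ : t₀ ∈ S) (hη : l t₀ 1 = η) {x : ℝ} (hx : x0 ≤ x)
    (hx' : x < x1) : ∃ U ∈ band l p S φ η y0, p U 0 ≤ x ∧ x < p U 0 + l U 0 := by
  have hst := h.isStack_column hx hx'
  have hx₀ : p t₀ 0 ≤ p t₀ 0 ∧ p t₀ 0 < p t₀ 0 + l t₀ 0 := ⟨le_rfl, by linarith [hl t₀ 0]⟩
  have hb := h.bounds ht₀ hx₀
  have hst₀ := h.isStack_column hb.1 hb.2
  have hy : y0 ≤ y1 := by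
    have h1 := hst₀.lo_le t₀ (mem_line.2 ⟨ht₀, hx₀⟩)
    have h2 := hst₀.le_hi t₀ (mem_line.2 ⟨ht₀, hx₀⟩)
    linarith [hl t₀ 1]
  obtain ⟨u, hu, huη⟩ := hst₀.exists_len_eq (fun t => by rw [hφ, hη]) hst hy (fun t => hl t 1)
    (mem_line.2 ⟨ht₀, hx₀⟩)
  obtain ⟨U, hU, hUmin⟩ := Finset.exists_min_image {t ∈ line l p S 0 x | l t 1 = η}
    (fun t => p t 1) ⟨u, Finset.mem_filter.2 ⟨hu, huη.trans hη⟩⟩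
  have hU' := Finset.mem_filter.1 hU
  have hU'' := mem_line.1 hU'.1
  refine ⟨U, mem_band.2 ⟨hU''.1, hU'.2, ?_⟩, hU''.2⟩
  rw [← hst.sum_below (fun t => hl t 1) φ hU'.1]
  refine Finset.sum_eq_zero fun t ht => ?_
  have ht' := Finset.mem_filter.1 ht
  rw [hφ, if_neg]
  intro htη
  have := hUmin t (Finset.mem_filter.2 ⟨ht'.1, htη⟩)
  linarith [hl t 1]

/-- No tile lies below one tile of the band and above or beside another. -/
theorem Tiles.band_wall {D U V : T} (hD : D ∈ S) (hU : U ∈ band l p S φ η y0)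
    (hV : V ∈ band l p S φ η y0) {x z : ℝ} (hxU : p U 0 ≤ x ∧ x < p U 0 + l U 0)
    (hxD : p D 0 ≤ x ∧ x < p D 0 + l D 0) (hzV : p V 0 ≤ z ∧ z < p V 0 + l V 0)
    (hzD : p D 0 ≤ z ∧ z < p D 0 + l D 0) (hDU : p D 1 + l D 1 ≤ p U 1)
    (hVD : p V 1 < p D 1 + l D 1) : False := by
  have hU' := mem_band.1 hU
  have hV' := mem_band.1 hV
  have hφ0 : ∀ t, 0 ≤ φ (l t 1) := fun t => by rw [hφ]; split_ifs <;> simp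
  have hb := h.bounds hD hxD
  have hst := h.isStack_column hb.1 hb.2
  have hb' := h.bounds hD hzD
  have hst' := h.isStack_column hb'.1 hb'.2
  -- The count below `U` is 0, so the count below `D` is 0 too. This number depends only on the
  -- height at which `D` lies, but in the column at `z` the tile `V` would contribute 1 to it.
  have h1 := hst.map_pos_add_le (fun t => hl t 1) hφ0 (mem_line.2 ⟨hD, hxD⟩)
    (mem_line.2 ⟨hU'.1, hxU⟩) hDU
  have h2 := hst.map_pos_nonneg (fun t => hl t 1) hφ0 (mem_line.2 ⟨hD, hxD⟩)
  rw [hU'.2.2] at h1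
  have hVne : V ≠ D := by
    rintro rfl
    have := hφ0 V
    rw [hφ, if_pos hV'.2.1] at h1
    linarith
  rcases hst'.le_or_le (fun t => hl t 1) (mem_line.2 ⟨hV'.1, hzV⟩) (mem_line.2 ⟨hD, hzD⟩) hVne
    with h3 | h3
  · have := hst'.map_pos_add_le (fun t => hl t 1) hφ0 (mem_line.2 ⟨hV'.1, hzV⟩)
      (mem_line.2 ⟨hD, hzD⟩) h3
    rw [hV'.2.2, hφ, if_pos hV'.2.1] at this
    linarith [hφ0 D]
  · linarith

end Band

end Plane

/-! ### Lowering the band to the floor -/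

section Descent

variable {T : Type} [DecidableEq T] {l p p' : T → Fin 2 → ℝ} {S R : Finset T}
  {x0 y0 x1 y1 η : ℝ} {φ : ℝ →+ ℝ}

/-- A maximal run of tiles of the band at its highest level, together with the bottom left tile
below this run. -/
theorem Tiles.exists_run (hl : ∀ t i, 0 < l t i)
    (hφ : ∀ t, φ (l t 1) = if l t 1 = η then 1 else 0) (h : Tiles l p S ![x0, y0] ![x1, y1])
    (hne : ∃ t ∈ band l p S φ η y0, p t 1 ≠ y0) :
    ∃ (R D : Finset T) (a b y : ℝ), R ⊆ S ∧ D ⊆ S ∧ a < b ∧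
      IsStack R (fun t => p t 0) (fun t => l t 0) a b ∧ (∀ t ∈ R, p t 1 = y ∧ l t 1 = η) ∧
      IsStack D (fun t => p t 0) (fun t => l t 0) a b ∧
      ∀ t ∈ D, p t 1 + l t 1 = y ∧ l t 1 ≠ η := by
  obtain ⟨t₁, ht₁, ht₁y⟩ := hne
  obtain ⟨t₂, ht₂, hmax⟩ := Finset.exists_max_image (band l p S φ η y0) (fun t => p t 1) ⟨t₁, ht₁⟩
  obtain ⟨y, hy⟩ : ∃ y, p t₂ 1 = y := ⟨_, rfl⟩
  rw [hy] at hmax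
  have hyy0 : y0 < y := ((h.lo_le t₁ (mem_band.1 ht₁).1 1).lt_of_ne ht₁y.symm).trans_le
    (hmax t₁ ht₁)
  obtain ⟨A, hA, hAmin⟩ := Finset.exists_min_image {t ∈ band l p S φ η y0 | p t 1 = y}
    (fun t => p t 0) ⟨t₂, Finset.mem_filter.2 ⟨ht₂, hy⟩⟩
  obtain ⟨hAb, hAy⟩ := Finset.mem_filter.1 hA
  have hAS := (mem_band.1 hAb).1
  have hAη := (mem_band.1 hAb).2.1
  obtain ⟨a, ha⟩ : ∃ a, p A 0 = a := ⟨_, rfl⟩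
  simp only [ha] at hAmin
  have hAa : p A 0 ≤ a ∧ a < p A 0 + l A 0 := ⟨ha.le, by linarith [hl A 0]⟩
  have hax := h.bounds hAS hAa
  -- the right end of the run
  obtain ⟨b, hab, hbx, hb1, hb2⟩ : ∃ b, a < b ∧ b ≤ x1 ∧
      (∀ t ∈ band l p S φ η y0, a < p t 0 → p t 0 < b → p t 1 = y) ∧
      (b < x1 → ∃ t ∈ band l p S φ η y0, p t 0 = b ∧ p t 1 < y) := by
    -- `b` is the left end of the first band tile right of `a` off the level `y`, or `x1` if there
    -- is none. As `y` is the highest level, such a tile is lower.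
    rcases Finset.eq_empty_or_nonempty {t ∈ band l p S φ η y0 | a < p t 0 ∧ p t 1 ≠ y} with h0 | h0
    · refine ⟨x1, hax.2, le_rfl, fun t ht h1 h2 => ?_, fun h => (lt_irrefl _ h).elim⟩
      by_contra hc
      exact Finset.notMem_empty t (h0 ▸ Finset.mem_filter.2 ⟨ht, h1, hc⟩)
    · obtain ⟨t, ht, hmin⟩ := Finset.exists_min_image _ (fun t => p t 0) h0
      obtain ⟨ht1, ht2, ht3⟩ := Finset.mem_filter.1 ht
      refine ⟨p t 0, ht2, ?_, fun s hs h1 h2 => ?_, fun _ => ⟨t, ht1, rfl, ?_⟩⟩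
      · have := h.le_hi t (mem_band.1 ht1).1 0
        simp only [Matrix.cons_val_zero] at this
        linarith [hl t 0]
      · by_contra hc
        exact absurd (hmin s (Finset.mem_filter.2 ⟨hs, h1, hc⟩)) (not_le.2 h2)
      · exact (hmax t ht1).lt_of_ne ht3
  have hcol : ∀ x, a ≤ x → x < b → ∃ U ∈ band l p S φ η y0,
      a ≤ p U 0 ∧ p U 0 < b ∧ (p U 0 ≤ x ∧ x < p U 0 + l U 0) := by
    intro x hx hx'
    obtain ⟨U, hU, hxU⟩ := h.band_exists hl hφ hAS hAη (hax.1.trans hx) (hx'.trans_le hbx)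
    refine ⟨U, hU, ?_, hxU.1.trans_lt hx', hxU⟩
    by_contra hc
    have := h.band_unique hl hφ hU hAb ⟨(not_le.1 hc).le, hx.trans_lt hxU.2⟩ hAa
    rw [this, ha] at hc
    exact hc le_rfl
  have hrun : ∀ U ∈ band l p S φ η y0, a ≤ p U 0 → p U 0 < b → p U 1 = y := by
    intro U hU h1 h2
    rcases h1.eq_or_lt with h1 | h1
    · have := h.band_unique hl hφ hU hAb (x := a) ⟨h1.ge, by linarith [hl U 0]⟩ hAa
      rw [this, hAy]
    · exact hb1 U hU h1 h2
  have hx0 : ∀ t ∈ S, x0 ≤ p t 0 := fun t ht => h.lo_le t ht 0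
  have hx1 : ∀ t ∈ S, p t 0 + l t 0 ≤ x1 := fun t ht => h.le_hi t ht 0
  -- no tile with top `y` sticks out of `[a, b)`
  have hwall : ∀ D ∈ S, p D 1 + l D 1 = y → ∀ x, a ≤ x → x < b →
      p D 0 ≤ x ∧ x < p D 0 + l D 0 → a ≤ p D 0 ∧ p D 0 + l D 0 ≤ b := by
    intro D hD hDy x hx hx' hxD
    obtain ⟨U, hU, hU1, hU2, hxU⟩ := hcol x hx hx'
    have hUy := hrun U hU hU1 hU2
    constructor
    · by_contra! hc
      have hDD : p D 0 ≤ p D 0 ∧ p D 0 < p D 0 + l D 0 := ⟨le_rfl, by linarith [hl D 0]⟩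
      have hbd := h.bounds hD hDD
      -- `V` starts left of `a`, so by the choice of `A` it lies below level `y`.
      obtain ⟨V, hV, hzV⟩ := h.band_exists hl hφ hAS hAη hbd.1 hbd.2
      refine h.band_wall hl hφ hD hU hV hxU hxD hzV hDD (by rw [hDy, hUy]) ?_
      rw [hDy]
      refine (hmax V hV).lt_of_ne fun hVy => ?_
      have := hAmin V (Finset.mem_filter.2 ⟨hV, hVy⟩)
      linarith [hzV.1]
    · by_contra! hc
      obtain ⟨V, hV, hVb, hVy⟩ := hb2 (hc.trans_le (hx1 D hD))
      exact h.band_wall hl hφ hD hU hV (z := b) hxU hxD ⟨hVb.le, by linarith [hl V 0]⟩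
        ⟨hxD.1.trans hx'.le, hc⟩ (by rw [hDy, hUy]) (by rw [hDy]; exact hVy)
  refine ⟨{t ∈ band l p S φ η y0 | a ≤ p t 0 ∧ p t 0 < b},
    {t ∈ S | p t 1 + l t 1 = y ∧ a ≤ p t 0 ∧ p t 0 + l t 0 ≤ b}, a, b, y,
    fun t ht => (mem_band.1 (Finset.mem_filter.1 ht).1).1, Finset.filter_subset _ _, hab,
    ⟨fun t ht => (Finset.mem_filter.1 ht).2.1, fun t ht => ?_, fun x hx hx' => ?_,
      fun t ht s hs x h1 h2 h3 h4 => ?_⟩, fun t ht => ?_,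
    ⟨fun t ht => (Finset.mem_filter.1 ht).2.2.1, fun t ht => (Finset.mem_filter.1 ht).2.2.2,
      fun x hx hx' => ?_, fun t ht s hs x h1 h2 h3 h4 => ?_⟩, fun t ht => ?_⟩
  · obtain ⟨htb, ht1, ht2⟩ := Finset.mem_filter.1 ht
    by_contra! hc
    obtain ⟨V, hV, hVb, hVy⟩ := hb2 (hc.trans_le (hx1 t (mem_band.1 htb).1))
    have := h.band_unique hl hφ htb hV (x := b) ⟨ht2.le, hc⟩ ⟨hVb.le, by linarith [hl V 0]⟩
    rw [this, hVb] at ht2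
    exact lt_irrefl _ ht2
  · obtain ⟨U, hU, hU1, hU2, hxU⟩ := hcol x hx hx'
    exact ⟨U, Finset.mem_filter.2 ⟨hU, hU1, hU2⟩, hxU⟩
  · exact h.band_unique hl hφ (Finset.mem_filter.1 ht).1 (Finset.mem_filter.1 hs).1 ⟨h1, h2⟩
      ⟨h3, h4⟩
  · obtain ⟨htb, ht1, ht2⟩ := Finset.mem_filter.1 ht
    exact ⟨hrun t htb ht1 ht2, (mem_band.1 htb).2.1⟩
  · obtain ⟨U, hU, hU1, hU2, hxU⟩ := hcol x hx hx'
    have hUy := hrun U hU hU1 hU2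
    have hst := h.isStack_column (hax.1.trans hx) (hx'.trans_le hbx)
    obtain ⟨D, hD, hDU⟩ := hst.exists_below (fun t => hl t 1)
      (mem_line.2 ⟨(mem_band.1 hU).1, hxU⟩) (by rw [hUy]; exact hyy0)
    have hD' := mem_line.1 hD
    rw [hUy] at hDU
    exact ⟨D, Finset.mem_filter.2 ⟨hD'.1, hDU, hwall D hD'.1 hDU x hx hx' hD'.2⟩, hD'.2⟩
  · obtain ⟨htS, hty, ht1, ht2⟩ := Finset.mem_filter.1 ht
    obtain ⟨hsS, hsy, hs1, hs2⟩ := Finset.mem_filter.1 hs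
    have hbd := h.bounds htS ⟨h1, h2⟩
    have hst := h.isStack_column hbd.1 hbd.2
    by_contra hne
    rcases hst.le_or_le (fun t => hl t 1) (mem_line.2 ⟨htS, h1, h2⟩) (mem_line.2 ⟨hsS, h3, h4⟩) hne
      with h5 | h5
    · linarith [hl s 1]
    · linarith [hl t 1]
  · obtain ⟨htS, hty, ht1, ht2⟩ := Finset.mem_filter.1 ht
    refine ⟨hty, fun htη => ?_⟩
    obtain ⟨U, hU, hU1, hU2, hxU⟩ := hcol (p t 0) ht1 (by linarith [hl t 0])
    have htt : p t 0 ≤ p t 0 ∧ p t 0 < p t 0 + l t 0 := ⟨le_rfl, by linarith [hl t 0]⟩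
    have hbd := h.bounds htS htt
    have hst := h.isStack_column hbd.1 hbd.2
    have hφ0 : ∀ t, 0 ≤ φ (l t 1) := fun t => by rw [hφ]; split_ifs <;> simp
    have h1 := hst.map_pos_add_le (fun t => hl t 1) hφ0 (mem_line.2 ⟨htS, htt⟩)
      (mem_line.2 ⟨(mem_band.1 hU).1, hxU⟩) (by rw [hty, hrun U hU hU1 hU2])
    have h2 := hst.map_pos_nonneg (fun t => hl t 1) hφ0 (mem_line.2 ⟨htS, htt⟩)
    rw [(mem_band.1 hU).2.2, hφ, if_pos htη] at h1
    linarith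

/-- The run and the tiles beneath it fill the same interval, so the run has a tile `A` as wide as
the leftmost tile `B` beneath. Moved to the left end of the run, `A` rests exactly on `B`, and
exchanging them lowers `A` by the height of `B`. The rise of `B` is not counted, since its height is
not `η`. -/
theorem Tiles.exists_lower (hl : ∀ t i, 0 < l t i) (hfree : Free l)
    (hφ : ∀ t, φ (l t 1) = if l t 1 = η then 1 else 0) (h : Tiles l p S ![x0, y0] ![x1, y1])
    (hne : ∃ t ∈ band l p S φ η y0, p t 1 ≠ y0) :
    ∃ p', Reach l S p p' ∧ ∃ B ∈ S,
      (∑ t ∈ S with l t 1 = η, p' t 1) + l B 1 = ∑ t ∈ S with l t 1 = η, p t 1 := by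
  obtain ⟨R, D, a, b, y, hRS, hDS, hab, hR, hRy, hD, hDy⟩ := h.exists_run hl hφ hne
  obtain ⟨B, hB, hBa, -⟩ := hD.exists_mem a le_rfl hab
  have hBa : p B 0 = a := le_antisymm hBa (hD.lo_le B hB)
  obtain ⟨ψ, hψ⟩ := hfree 0 B
  obtain ⟨A, hA, hAB⟩ := hD.exists_len_eq hψ hR hab.le (fun t => hl t 0) hB
  have hRt := hR.tiles hRy
  have hRη : ∀ t ∈ R, l t 1 = y + η - y := fun t ht => by linarith [(hRy t ht).2]
  obtain ⟨p₁, hp₁, hp₁A⟩ := exists_reach_front hl hRt hRη hA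
  have hp₁y : ∀ t, p₁ t 1 = p t 1 := by
    intro t
    by_cases ht : t ∈ R
    · rw [(hRt.reach hl hp₁).row_pos hRη ht, (hRy t ht).1]
    · rw [hp₁.eq_of_notMem ht]
  have hBR : B ∉ R := fun hBR => (hDy B hB).2 (hRy B hBR).2
  have hF : Follows l p₁ 1 B A := by
    refine ⟨?_, fun j hj => ?_⟩
    · rw [hp₁y, hp₁y, (hRy A hA).1, (hDy B hB).1]
    · obtain rfl : j = 0 := by omega
      rw [hp₁A, hp₁.eq_of_notMem hBR, hBa]
      exact ⟨rfl, hAB⟩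
  refine ⟨exchange l p₁ 1 B A, (hp₁.mono hRS).tail ⟨1, B, hDS hB, A, hRS hA, hF, rfl⟩, B, hDS hB,
    ?_⟩
  have hAmem : A ∈ S.filter fun t => l t 1 = η := Finset.mem_filter.2 ⟨hRS hA, (hRy A hA).2⟩
  rw [← Finset.add_sum_erase _ _ hAmem, ← Finset.add_sum_erase _ _ hAmem,
    exchange_right _ (hF.ne hl), ← hp₁y A, hF.1]
  have : ∑ t ∈ (S.filter fun t => l t 1 = η).erase A, exchange l p₁ 1 B A t 1 =
      ∑ t ∈ (S.filter fun t => l t 1 = η).erase A, p t 1 := by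
    refine Finset.sum_congr rfl fun t ht => ?_
    obtain ⟨htA, ht⟩ := Finset.mem_erase.1 ht
    rw [exchange_of_ne _ _ htA, hp₁y]
    rintro rfl
    exact (hDy t hB).2 (Finset.mem_filter.1 ht).2
  rw [this]
  ring

/-- The levels of the tiles of height `η` have a sum bounded below, and each lowering decreases it
by at least the smallest height of a tile. -/
theorem Tiles.exists_band_lowest (hl : ∀ t i, 0 < l t i) (hfree : Free l)
    (hφ : ∀ t, φ (l t 1) = if l t 1 = η then 1 else 0) (h : Tiles l p S ![x0, y0] ![x1, y1]) :
    ∃ p', Reach l S p p' ∧ ∀ t ∈ band l p' S φ η y0, p' t 1 = y0 := by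
  rcases S.eq_empty_or_nonempty with rfl | hS
  · exact ⟨p, .refl, fun t ht => (Finset.notMem_empty t (mem_band.1 ht).1).elim⟩
  obtain ⟨m, hm, hmin⟩ := Finset.exists_min_image S (fun t => l t 1) hS
  have hδ := hl m 1
  obtain ⟨n, hn⟩ := Archimedean.arch
    ((∑ t ∈ S with l t 1 = η, p t 1) - ∑ t ∈ S with l t 1 = η, y0) hδ
  induction n generalizing p with
  | zero =>
    refine ⟨p, .refl, fun t ht => ?_⟩
    by_contra hc
    obtain ⟨p', hp', B, hB, hsum⟩ := h.exists_lower hl hfree hφ ⟨t, ht, hc⟩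
    have : ∑ t ∈ S with l t 1 = η, y0 ≤ ∑ t ∈ S with l t 1 = η, p' t 1 :=
      Finset.sum_le_sum fun t ht =>
        (h.reach hl hp').lo_le t (Finset.mem_filter.1 ht).1 1
    rw [zero_smul] at hn
    linarith [hl B 1]
  | succ n ih =>
    by_cases hc : ∀ t ∈ band l p S φ η y0, p t 1 = y0
    · exact ⟨p, .refl, hc⟩
    push Not at hc
    obtain ⟨p', hp', B, hB, hsum⟩ := h.exists_lower hl hfree hφ hc
    obtain ⟨p'', hp'', hp''b⟩ := ih (h.reach hl hp') (by
      rw [succ_nsmul] at hn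
      linarith [hmin B hB])
    exact ⟨p'', hp'.trans hp'', hp''b⟩

/-- Every tiling can be rearranged such that its lowest tiles form a row of prescribed height. -/
theorem Tiles.exists_bottom_row (hl : ∀ t i, 0 < l t i) (hfree : Free l)
    (h : Tiles l p S ![x0, y0] ![x1, y1]) {t₀ : T} (ht₀ : t₀ ∈ S) :
    ∃ p', Reach l S p p' ∧ ∃ R ⊆ S, R.Nonempty ∧ (∀ t ∈ R, l t 1 = l t₀ 1) ∧
      Tiles l p' R ![x0, y0] ![x1, y0 + l t₀ 1] ∧
      Tiles l p' (S \ R) ![x0, y0 + l t₀ 1] ![x1, y1] := by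
  obtain ⟨φ, hφ⟩ := hfree 1 t₀
  obtain ⟨p', hp', hband⟩ := h.exists_band_lowest hl hfree hφ
  have h' := h.reach hl hp'
  have hRS : band l p' S φ (l t₀ 1) y0 ⊆ S := Finset.filter_subset _ _
  have hη : ∀ t ∈ band l p' S φ (l t₀ 1) y0, l t 1 = l t₀ 1 := fun t ht => (mem_band.1 ht).2.1
  have htop : ∀ t ∈ band l p' S φ (l t₀ 1) y0, p' t 1 + l t 1 ≤ y0 + l t₀ 1 := fun t ht => by
    rw [hband t ht, hη t ht]
  -- The band lies on the floor and meets every column, so every other tile is above it.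
  have habove : ∀ t ∈ S, t ∉ band l p' S φ (l t₀ 1) y0 → y0 + l t₀ 1 ≤ p' t 1 := by
    intro t ht htb
    have htt : p' t 0 ≤ p' t 0 ∧ p' t 0 < p' t 0 + l t 0 := ⟨le_rfl, by linarith [hl t 0]⟩
    have hbd := h'.bounds ht htt
    obtain ⟨U, hU, hxU⟩ := h'.band_exists hl hφ ht₀ rfl hbd.1 hbd.2
    have hst := h'.isStack_column hbd.1 hbd.2
    have hlo : y0 ≤ p' t 1 := h'.lo_le t ht 1
    rcases hst.le_or_le (fun t => hl t 1) (mem_line.2 ⟨ht, htt⟩) (mem_line.2 ⟨hRS hU, hxU⟩)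
      (by rintro rfl; exact htb hU) with h1 | h1
    · rw [hband U hU] at h1
      linarith [hl t 1]
    · rwa [hband U hU, hη U hU] at h1
  have hlo₀ := h'.lo_le t₀ ht₀ 1
  have hhi₀ := h'.le_hi t₀ ht₀ 1
  simp only [Matrix.cons_val_one, Matrix.cons_val_fin_one] at hlo₀ hhi₀
  have h1 := h'.cut_below hRS (i := 1) (c := y0 + l t₀ 1)
    (by simp only [Matrix.cons_val_one, Matrix.cons_val_fin_one]; linarith) htop habove
  have h2 := h'.cut_above (i := 1) (c := y0 + l t₀ 1)
    (by simpa using (hl t₀ 1).le) htop habove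
  have e1 : Function.update ![x1, y1] 1 (y0 + l t₀ 1) = ![x1, y0 + l t₀ 1] := by
    ext j; fin_cases j <;> simp
  have e2 : Function.update ![x0, y0] 1 (y0 + l t₀ 1) = ![x0, y0 + l t₀ 1] := by
    ext j; fin_cases j <;> simp
  rw [e1] at h1
  rw [e2] at h2
  have htt : p' t₀ 0 ≤ p' t₀ 0 ∧ p' t₀ 0 < p' t₀ 0 + l t₀ 0 := ⟨le_rfl, by linarith [hl t₀ 0]⟩
  have hbd := h'.bounds ht₀ htt
  obtain ⟨U, hU, -⟩ := h'.band_exists hl hφ ht₀ rfl hbd.1 hbd.2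
  exact ⟨p', hp', _, hRS, ⟨U, hU⟩, hη, h1, h2⟩

end Descent

/-! ### Matching two tilings up to congruent tiles -/

section Matching

variable {T : Type} [DecidableEq T] {l p q p' : T → Fin 2 → ℝ} {S S' R R' : Finset T}
  {x0 y0 x1 y1 : ℝ}

theorem Tiles.remove_front (hl : ∀ t i, 0 < l t i) (h : Tiles l p R ![x0, y0] ![x1, y1])
    (hR : ∀ t ∈ R, l t 1 = y1 - y0) {A : T} (hA : A ∈ R) (hA0 : p A 0 = x0) :
    Tiles l p (R \ {A}) ![x0 + l A 0, y0] ![x1, y1] := by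
  have hst := h.row_isStack hR (by linarith [hl A 1, hR A hA])
  have h1 := h.cut_above (R := {A}) (i := 0) (c := x0 + l A 0)
    (by simpa using (hl A 0).le) (by simp [hA0]) (fun t ht htA => by
      rw [Finset.mem_singleton] at htA
      have := hst.lo_le t ht
      rcases hst.le_or_le (fun t => hl t 0) ht hA htA with h2 | h2
      · linarith [hl t 0]
      · linarith)
  have e : Function.update ![x0, y0] 0 (x0 + l A 0) = ![x0 + l A 0, y0] := by
    ext j; fin_cases j <;> simp
  rwa [e] at h1

theorem card_sdiff_lt (hRS : R ⊆ S) (hR : R.Nonempty) : (S \ R).card < S.card :=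
  Finset.card_lt_card (Finset.sdiff_ssubset hRS hR)

/-- By counting, the width of the first tile of the target row occurs in the other row; a tile of
that width is brought to the front, both are removed, and induction applies. -/
theorem exists_row_match (hl : ∀ t i, 0 < l t i) (hfree : Free l)
    (h : Tiles l p R ![x0, y0] ![x1, y1]) (hR : ∀ t ∈ R, l t 1 = y1 - y0)
    (h' : Tiles l q R' ![x0, y0] ![x1, y1]) (hR' : ∀ t ∈ R', l t 1 = y1 - y0) :
    ∃ p', Reach l R p p' ∧ ∀ t ∈ R, ∃ t' ∈ R', l t' = l t ∧ q t' = p' t := by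
  obtain ⟨n, hn⟩ : ∃ n, R.card = n := ⟨_, rfl⟩
  induction n using Nat.strong_induction_on generalizing p R R' x0 with
  | _ n ih =>
    rcases R.eq_empty_or_nonempty with rfl | ⟨t₀, ht₀⟩
    · exact ⟨p, .refl, by simp⟩
    have hy : y0 < y1 := by linarith [hl t₀ 1, hR t₀ ht₀]
    have hst := h.row_isStack hR hy
    have hst' := h'.row_isStack hR' hy
    have hx : x0 < x1 := by linarith [hl t₀ 0, hst.lo_le t₀ ht₀, hst.le_hi t₀ ht₀]
    obtain ⟨B, hB, hB0, -⟩ := hst'.exists_mem x0 le_rfl hx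
    have hB0 : q B 0 = x0 := hB0.antisymm (hst'.lo_le B hB)
    obtain ⟨φ, hφ⟩ := hfree 0 B
    obtain ⟨A, hA, hAB⟩ := hst'.exists_len_eq hφ hst hx.le (fun t => hl t 0) hB
    have hlAB : l B = l A := by
      ext j; fin_cases j
      · exact hAB.symm
      · exact (hR' B hB).trans (hR A hA).symm
    obtain ⟨p₁, hp₁, hp₁A⟩ := exists_reach_front hl h hR hA
    have h₁ := h.reach hl hp₁
    have h₂ := h₁.remove_front hl hR hA hp₁A
    have h₂' := h'.remove_front hl hR' hB hB0
    rw [hlAB] at h₂'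
    obtain ⟨p₂, hp₂, hm⟩ := ih _ (hn ▸ card_sdiff_lt (by simpa using hA) (by simp)) h₂
      (fun t ht => hR t (Finset.mem_sdiff.1 ht).1) h₂'
      (fun t ht => hR' t (Finset.mem_sdiff.1 ht).1) rfl
    refine ⟨p₂, hp₁.trans (hp₂.mono Finset.sdiff_subset), fun t ht => ?_⟩
    by_cases htA : t = A
    · subst htA
      refine ⟨B, hB, hlAB, ?_⟩
      rw [hp₂.eq_of_notMem (by simp)]
      ext j; fin_cases j
      · exact hB0.trans hp₁A.symm
      · exact (h'.row_pos hR' hB).trans (h₁.row_pos hR ht).symm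
    · obtain ⟨t', ht', h3⟩ := hm t (by simp [ht, htA])
      exact ⟨t', (Finset.mem_sdiff.1 ht').1, h3⟩

/-- Bottom rows of one height are formed in both tilings, matched and removed. Matched rows may
carry different labels, which is why the induction needs two label sets `S` and `S'`. -/
theorem exists_match (hl : ∀ t i, 0 < l t i) (hfree : Free l)
    (h : Tiles l p S ![x0, y0] ![x1, y1]) (h' : Tiles l q S' ![x0, y0] ![x1, y1]) :
    ∃ p' q', Reach l S p p' ∧ Reach l S' q q' ∧
      ∀ t ∈ S, ∃ t' ∈ S', l t' = l t ∧ q' t' = p' t := by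
  obtain ⟨n, hn⟩ : ∃ n, S.card = n := ⟨_, rfl⟩
  induction n using Nat.strong_induction_on generalizing p q S S' y0 with
  | _ n ih =>
    rcases S.eq_empty_or_nonempty with rfl | ⟨t₀, ht₀⟩
    · exact ⟨p, q, .refl, .refl, by simp⟩
    have htt : p t₀ 0 ≤ p t₀ 0 ∧ p t₀ 0 < p t₀ 0 + l t₀ 0 := ⟨le_rfl, by linarith [hl t₀ 0]⟩
    have hbd := h.bounds ht₀ htt
    have hst := h.isStack_column hbd.1 hbd.2
    have hst' := h'.isStack_column hbd.1 hbd.2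
    have ht₀' := mem_line.2 ⟨ht₀, htt⟩
    obtain ⟨φ, hφ⟩ := hfree 1 t₀
    obtain ⟨u₀, hu₀, hu₀η⟩ := hst.exists_len_eq hφ hst'
      (by linarith [hst.lo_le _ ht₀', hst.le_hi _ ht₀', hl t₀ 1]) (fun t => hl t 1) ht₀'
    obtain ⟨p₁, hp₁, R, hRS, hRne, hRη, hR, hSR⟩ := h.exists_bottom_row hl hfree ht₀
    obtain ⟨q₁, hq₁, R', hRS', -, hRη', hR', hSR'⟩ :=
      h'.exists_bottom_row hl hfree (mem_line.1 hu₀).1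
    rw [hu₀η] at hR' hSR'
    obtain ⟨p₂, hp₂, hm⟩ := exists_row_match hl hfree hR (fun t ht => by rw [hRη t ht]; ring) hR'
      (fun t ht => by rw [hRη' t ht, hu₀η]; ring)
    have hSR₂ := hSR.congr (p' := p₂) fun t ht => hp₂.eq_of_notMem (Finset.mem_sdiff.1 ht).2
    obtain ⟨p₃, q₃, hp₃, hq₃, hm'⟩ := ih _ (hn ▸ card_sdiff_lt hRS hRne) hSR₂ hSR' rfl
    refine ⟨p₃, q₃, (hp₁.trans (hp₂.mono hRS)).trans (hp₃.mono Finset.sdiff_subset),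
      hq₁.trans (hq₃.mono Finset.sdiff_subset), fun t ht => ?_⟩
    by_cases htR : t ∈ R
    · obtain ⟨t', ht', h1, h2⟩ := hm t htR
      refine ⟨t', hRS' ht', h1, ?_⟩
      rw [hq₃.eq_of_notMem (by simp [ht']), hp₃.eq_of_notMem (by simp [htR]), h2]
    · obtain ⟨t', ht', h3⟩ := hm' t (Finset.mem_sdiff.2 ⟨ht, htR⟩)
      exact ⟨t', (Finset.mem_sdiff.1 ht').1, h3⟩

/-! ### Permuting tiles of the same shape -/

theorem Step.comp_perm {π : Equiv.Perm T} (hπ : ∀ t, l (π t) = l t) (hS : ∀ t, π t ∈ S ↔ t ∈ S)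
    (h : Step l S p p') : Step l S (fun t => p (π t)) (fun t => p' (π t)) := by
  obtain ⟨i, s, hs, t, ht, hF, rfl⟩ := h
  have hπ' : ∀ t, l (π.symm t) = l t := fun t => by rw [← hπ, π.apply_symm_apply]
  refine ⟨i, π.symm s, (hS _).1 (by simpa using hs), π.symm t, (hS _).1 (by simpa using ht), ?_, ?_⟩
  · simpa [Follows, hπ'] using hF
  · ext u j
    simp only [exchange, hπ', Equiv.eq_symm_apply, Equiv.apply_symm_apply]
    split_ifs <;> rfl

theorem Reach.comp_perm {π : Equiv.Perm T} (hπ : ∀ t, l (π t) = l t) (hS : ∀ t, π t ∈ S ↔ t ∈ S)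
    (h : Reach l S p p') : Reach l S (fun t => p (π t)) (fun t => p' (π t)) := by
  induction h with
  | refl => exact .refl
  | tail _ h ih => exact ih.tail (h.comp_perm hπ hS)

/-- After the path to `p ∘ σ`, the path to `p ∘ π` is followed with labels permuted by `σ`. -/
theorem Reach.comp_mul {π σ : Equiv.Perm T} (hσ : ∀ t, l (σ t) = l t)
    (hS : ∀ t, σ t ∈ S ↔ t ∈ S) (h : Reach l S p fun t => p (π t))
    (h' : Reach l S p fun t => p (σ t)) : Reach l S p fun t => p ((π * σ) t) :=
  h'.trans (h.comp_perm hσ hS)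

/-- The tiles `s` and `t` can be exchanged by finitely many steps within `S`. -/
def Swappable (l : T → Fin 2 → ℝ) (S : Finset T) (p : T → Fin 2 → ℝ) (s t : T) : Prop :=
  Reach l S p fun u => p (Equiv.swap s t u)

theorem apply_swap {s t : T} (h : l s = l t) (u : T) : l (Equiv.swap s t u) = l u := by
  by_cases hs : u = s
  · subst hs; simp [h]
  · by_cases ht : u = t
    · subst ht; simp [h]
    · rw [Equiv.swap_apply_of_ne_of_ne hs ht]

theorem swap_mem_iff {s t : T} (hs : s ∈ S) (ht : t ∈ S) (u : T) :
    Equiv.swap s t u ∈ S ↔ u ∈ S := by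
  by_cases hus : u = s
  · subst hus; simp [hs, ht]
  · by_cases hut : u = t
    · subst hut; simp [hs, ht]
    · rw [Equiv.swap_apply_of_ne_of_ne hus hut]

theorem Swappable.mono {s t : T} (hRS : R ⊆ S) (h : Swappable l R p s t) : Swappable l S p s t :=
  Reach.mono hRS h

theorem Swappable.symm {s t : T} (h : Swappable l S p s t) : Swappable l S p t s := by
  unfold Swappable
  rwa [Equiv.swap_comm]

/-- Conjugation: go to `p'`, swap there, and retrace the path with `s` and `t` interchanged. -/
theorem Swappable.of_reach (hl : ∀ t i, 0 < l t i) {s t : T} (hs : s ∈ S) (ht : t ∈ S)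
    (hst : l s = l t) (h : Reach l S p p') (h' : Swappable l S p' s t) : Swappable l S p s t :=
  (h.trans h').trans ((h.symm hl).comp_perm (apply_swap hst) (swap_mem_iff hs ht))

/-- For distinct labels, `swap s u` is the conjugate of `swap s t` by `swap t u`. -/
theorem Swappable.trans {s t u : T} (hs : s ∈ S) (ht : t ∈ S) (hu : u ∈ S) (hst : l s = l t)
    (htu : l t = l u) (h : Swappable l S p s t) (h' : Swappable l S p t u) :
    Swappable l S p s u := by
  by_cases h1 : t = s
  · subst h1; exact h'
  by_cases h2 : t = u
  · subst h2; exact h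
  by_cases h3 : s = u
  · subst h3; unfold Swappable; rw [Equiv.swap_self]; exact .refl
  unfold Swappable
  rw [Equiv.swap_comm, ← Equiv.swap_mul_swap_mul_swap (Ne.symm h1) h3, mul_assoc]
  refine Reach.comp_mul (fun v => ?_) (fun v => ?_) h' ?_
  · rw [Equiv.Perm.mul_apply, apply_swap hst, apply_swap htu]
  · rw [Equiv.Perm.mul_apply, swap_mem_iff hs ht, swap_mem_iff ht hu]
  · exact Reach.comp_mul (apply_swap htu) (swap_mem_iff ht hu) h h'

theorem Follows.swappable (hl : ∀ t i, 0 < l t i) {i : Fin 2} {s t : T} (hs : s ∈ S) (ht : t ∈ S)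
    (h : Follows l p i s t) (hst : l s = l t) : Swappable l S p s t := by
  refine Relation.ReflTransGen.single ⟨i, s, hs, t, ht, h, ?_⟩
  have hne := h.ne hl
  ext u j
  by_cases hus : u = s
  · subst hus
    by_cases hj : j = i
    · subst hj; rw [exchange_left, Equiv.swap_apply_left, h.1, hst]
    · rw [exchange_of_ne_dir hj, Equiv.swap_apply_left, (h.2 j hj).1]
  · by_cases hut : u = t
    · subst hut
      by_cases hj : j = i
      · subst hj; rw [exchange_right _ hne, Equiv.swap_apply_right]
      · rw [exchange_of_ne_dir hj, Equiv.swap_apply_right, (h.2 j hj).1]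
    · rw [exchange_of_ne _ hus hut, Equiv.swap_apply_of_ne_of_ne hus hut]

/-- Bringing `s` to the front, and then `t` to the front of the rest, makes them adjacent. -/
theorem Tiles.swappable_of_row (hl : ∀ t i, 0 < l t i) (h : Tiles l p R ![x0, y0] ![x1, y1])
    (hR : ∀ t ∈ R, l t 1 = y1 - y0) {s t : T} (hs : s ∈ R) (ht : t ∈ R) (hne : s ≠ t)
    (hst : l s = l t) : Swappable l R p s t := by
  obtain ⟨p₁, hp₁, hp₁s⟩ := exists_reach_front hl h hR hs
  have h₁ := h.reach hl hp₁
  have h₂ := h₁.remove_front hl hR hs hp₁s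
  obtain ⟨p₂, hp₂, hp₂t⟩ := exists_reach_front hl h₂
    (fun t ht => hR t (Finset.mem_sdiff.1 ht).1) (A := t) (by simp [ht, hne.symm])
  have hp₂' := hp₁.trans (hp₂.mono Finset.sdiff_subset)
  have h₃ := h.reach hl hp₂'
  refine Swappable.of_reach hl hs ht hst hp₂' (Follows.swappable hl (i := 0) hs ht ⟨?_, ?_⟩ hst)
  · rw [hp₂t, hp₂.eq_of_notMem (u := s) (by simp), hp₁s]
  · intro j hj
    obtain rfl : j = 1 := by omega
    rw [h₃.row_pos hR hs, h₃.row_pos hR ht, hst]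
    exact ⟨rfl, rfl⟩

/-- With both tiles at the left ends of their rows, `t` rests exactly on `s`. -/
theorem Tiles.swappable_of_rows (hl : ∀ t i, 0 < l t i) {y2 : ℝ}
    (h : Tiles l p R ![x0, y0] ![x1, y1]) (hR : ∀ t ∈ R, l t 1 = y1 - y0)
    (h' : Tiles l p R' ![x0, y1] ![x1, y2]) (hR' : ∀ t ∈ R', l t 1 = y2 - y1)
    (hRR' : Disjoint R R') {s t : T} (hs : s ∈ R) (ht : t ∈ R') (hst : l s = l t) :
    Swappable l (R ∪ R') p s t := by
  obtain ⟨p₁, hp₁, hp₁s⟩ := exists_reach_front hl h hR hs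
  have h₁ := h'.congr (p' := p₁) fun u hu =>
    hp₁.eq_of_notMem (Finset.disjoint_right.1 hRR' hu)
  obtain ⟨p₂, hp₂, hp₂t⟩ := exists_reach_front hl h₁ hR' ht
  have hs' : p₂ s = p₁ s := hp₂.eq_of_notMem (Finset.disjoint_left.1 hRR' hs)
  refine Swappable.of_reach hl (Finset.mem_union_left _ hs) (Finset.mem_union_right _ ht) hst
    ((hp₁.mono Finset.subset_union_left).trans (hp₂.mono Finset.subset_union_right))
    (Follows.swappable hl (i := 1) (Finset.mem_union_left _ hs) (Finset.mem_union_right _ ht)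
      ⟨?_, ?_⟩ hst)
  · rw [hs', (h.reach hl hp₁).row_pos hR hs, (h₁.reach hl hp₂).row_pos hR' ht, hR s hs]
    ring
  · intro j hj
    obtain rfl : j = 0 := by omega
    rw [hs', hp₁s, hp₂t, hst]
    exact ⟨rfl, rfl⟩

/-- A bottom row of the height of `s` is formed. Two tiles in it are swapped inside the row, two
tiles above it by induction. For `a` in the row and `b` above, a second row of the same height is
formed on top of the first. By counting it contains some `u` congruent to `a`; then `a` is swapped
with `u` across the two rows, and `u` with `b` by induction. -/
theorem Tiles.swappable (hl : ∀ t i, 0 < l t i) (hfree : Free l)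
    (h : Tiles l p S ![x0, y0] ![x1, y1]) {s t : T} (hs : s ∈ S) (ht : t ∈ S) (hst : l s = l t) :
    Swappable l S p s t := by
  obtain ⟨n, hn⟩ : ∃ n, S.card = n := ⟨_, rfl⟩
  induction n using Nat.strong_induction_on generalizing p S y0 s t with
  | _ n ih =>
    by_cases hne : s = t
    · subst hne; unfold Swappable; rw [Equiv.swap_self]; exact .refl
    obtain ⟨p₁, hp₁, R, hRS, hRne, hRη, hR, hSR⟩ := h.exists_bottom_row hl hfree hs
    have hR1 : ∀ t ∈ R, l t 1 = y0 + l s 1 - y0 := fun t ht => by rw [hRη t ht]; ring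
    have hcard := hn ▸ card_sdiff_lt hRS hRne
    refine Swappable.of_reach hl hs ht hst hp₁ ?_
    -- a tile of the bottom row and one above it
    have hmixed : ∀ a b, a ∈ R → b ∈ S → b ∉ R → l a = l b → Swappable l S p₁ a b := by
      intro a b ha hb hbR hab
      have hb' := Finset.mem_sdiff.2 ⟨hb, hbR⟩
      obtain ⟨p₂, hp₂, R₂, hR₂S, -, hR₂η, hR₂, -⟩ := hSR.exists_bottom_row hl hfree hb'
      have hbs : l b 1 = l s 1 := by rw [← hab, hRη a ha]
      have hR₂1 : ∀ t ∈ R₂, l t 1 = y0 + l s 1 + l b 1 - (y0 + l s 1) := fun t ht => by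
        rw [hR₂η t ht]; ring
      have hRp₂ := hR.congr (p' := p₂) fun u hu => hp₂.eq_of_notMem (by simp [hu])
      have hx : x0 ≤ x1 := by
        have h1 := hR.lo_le a ha 0
        have h2 := hR.le_hi a ha 0
        simp only [Matrix.cons_val_zero] at h1 h2
        linarith [hl a 0]
      obtain ⟨ψ, hψ⟩ := hfree 0 a
      obtain ⟨u, hu, hua⟩ := (hRp₂.row_isStack hR1 (by linarith [hl s 1])).exists_len_eq hψ
        (hR₂.row_isStack hR₂1 (by linarith [hl b 1])) hx (fun t => hl t 0) ha
      have hlu : l a = l u := by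
        ext j; fin_cases j
        · exact hua.symm
        · exact ((hRη a ha).trans hbs.symm).trans (hR₂η u hu).symm
      have huS := hR₂S hu
      have hd : Disjoint R R₂ := Finset.disjoint_left.2 fun v hv hv' =>
        (Finset.mem_sdiff.1 (hR₂S hv')).2 hv
      refine Swappable.of_reach hl (hRS ha) hb hab (hp₂.mono Finset.sdiff_subset) ?_
      refine Swappable.trans (hRS ha) (Finset.mem_sdiff.1 huS).1 hb hlu (hlu.symm.trans hab) ?_ ?_
      · exact (hRp₂.swappable_of_rows hl hR1 hR₂ hR₂1 hd ha hu hlu).mono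
          (Finset.union_subset hRS (hR₂S.trans Finset.sdiff_subset))
      · exact (ih _ hcard (hSR.reach hl hp₂) huS hb' (hlu.symm.trans hab) rfl).mono
          Finset.sdiff_subset
    by_cases hsR : s ∈ R <;> by_cases htR : t ∈ R
    · exact (hR.swappable_of_row hl hR1 hsR htR hne hst).mono hRS
    · exact hmixed s t hsR ht htR hst
    · exact (hmixed t s htR hs hsR hst.symm).symm
    · exact (ih _ hcard hSR (Finset.mem_sdiff.2 ⟨hs, hsR⟩) (Finset.mem_sdiff.2 ⟨ht, htR⟩) hst
        rfl).mono Finset.sdiff_subset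

/-! ### Connectedness of the set of tilings of a box -/

variable [Fintype T]

/-- Swaps of congruent tiles generate all shape-preserving permutations, since `t` and `π t` always
lie in one orbit of the group they generate. -/
theorem Tiles.reach_perm (hl : ∀ t i, 0 < l t i) (hfree : Free l)
    (h : Tiles l p Finset.univ ![x0, y0] ![x1, y1]) {π : Equiv.Perm T} (hπ : ∀ t, l (π t) = l t) :
    Reach l Finset.univ p fun t => p (π t) := by
  have hmem : π ∈ Subgroup.closure
      {σ : Equiv.Perm T | ∃ s t, s ≠ t ∧ l s = l t ∧ σ = Equiv.swap s t} := by
    refine (mem_closure_isSwap fun σ hσ => ?_).2 ⟨Set.toFinite _, fun t => ?_⟩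
    · obtain ⟨s, t, hne, -, hσ⟩ := hσ
      exact ⟨s, t, hne, hσ⟩
    by_cases ht : t = π t
    · rw [← ht]; exact MulAction.mem_orbit_self _
    · exact ⟨⟨Equiv.swap t (π t), Subgroup.subset_closure ⟨t, π t, ht, (hπ t).symm, rfl⟩⟩,
        Equiv.swap_apply_left t (π t)⟩
  suffices ∀ σ ∈ Subgroup.closure
      {σ : Equiv.Perm T | ∃ s t, s ≠ t ∧ l s = l t ∧ σ = Equiv.swap s t},
      (∀ t, l (σ t) = l t) ∧ Reach l Finset.univ p fun t => p (σ t) from (this π hmem).2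
  intro σ hσ
  induction hσ using Subgroup.closure_induction with
  | mem σ hσ =>
    obtain ⟨s, t, -, hst, rfl⟩ := hσ
    exact ⟨apply_swap hst, h.swappable hl hfree (Finset.mem_univ s) (Finset.mem_univ t) hst⟩
  | one => exact ⟨fun _ => rfl, .refl⟩
  | mul σ τ _ _ hσ hτ =>
    exact ⟨fun t => by rw [Equiv.Perm.mul_apply, hσ.1, hτ.1],
      Reach.comp_mul hτ.1 (by simp) hσ.2 hτ.2⟩
  | inv σ _ hσ =>
    have h1 : ∀ t, l (σ⁻¹ t) = l t := fun t => by
      rw [← hσ.1, ← Equiv.Perm.mul_apply, mul_inv_cancel, Equiv.Perm.one_apply]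
    refine ⟨h1, Reach.symm hl ?_⟩
    simpa using hσ.2.comp_perm h1 (by simp)

/-- Any two tilings of a box by the same tiles are connected by exchanges. -/
theorem Tiles.reach_tiles (hl : ∀ t i, 0 < l t i) (hfree : Free l)
    (h : Tiles l p Finset.univ ![x0, y0] ![x1, y1])
    (h' : Tiles l q Finset.univ ![x0, y0] ![x1, y1]) : Reach l Finset.univ p q := by
  obtain ⟨p', q', hp, hq, hm⟩ := exists_match hl hfree h h'
  choose π hπ using fun t => hm t (Finset.mem_univ t)
  -- Two tiles with the same partner would share their lowest corner.
  have hinj : Function.Injective π := by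
    intro s t hst
    refine (h.reach hl hp).unique s (Finset.mem_univ s) t (Finset.mem_univ t) (p' s)
      (fun i => ⟨le_rfl, by linarith [hl s i]⟩) (fun i => ?_)
    rw [← (hπ s).2.2, hst, (hπ t).2.2]
    exact ⟨le_rfl, by linarith [hl t i]⟩
  have hperm := (h'.reach hl hq).reach_perm hl hfree
    (π := Equiv.ofBijective π (Finite.injective_iff_bijective.1 hinj)) (fun t => (hπ t).2.1)
  have e : (fun t => q' (Equiv.ofBijective π (Finite.injective_iff_bijective.1 hinj) t)) = p' :=
    funext fun t => (hπ t).2.2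
  rw [e] at hperm
  exact hp.trans (Reach.symm hl (hq.trans hperm))

/-- In a tiling with at least two tiles some exchange is possible. -/
theorem Tiles.exists_step (hl : ∀ t i, 0 < l t i) (hfree : Free l)
    (h : Tiles l p Finset.univ ![x0, y0] ![x1, y1]) {s t : T} (hst : s ≠ t) :
    ∃ p', Step l Finset.univ p p' := by
  by_contra! hc
  -- If no exchange is possible, whatever exchanges can achieve holds for `p` already: it has a
  -- bottom row, and every tile of that row is at its left end, so the row is a single tile `A`.
  have hstuck : ∀ p', Reach l Finset.univ p p' → p' = p := by
    intro p' hp'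
    rcases Relation.ReflTransGen.cases_head hp' with h1 | ⟨r, h1, -⟩
    · exact h1.symm
    · exact (hc r h1).elim
  obtain ⟨p₁, hp₁, R, -, ⟨A, hA⟩, hRη, hR, hSR⟩ := h.exists_bottom_row hl hfree (Finset.mem_univ s)
  obtain rfl := hstuck _ hp₁
  have hR1 : ∀ t ∈ R, l t 1 = y0 + l s 1 - y0 := fun t ht => by rw [hRη t ht]; ring
  have hx0 : ∀ B ∈ R, p₁ B 0 = x0 := by
    intro B hB
    obtain ⟨p₂, hp₂, hp₂B⟩ := exists_reach_front hl hR hR1 hB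
    rwa [hstuck _ (hp₂.mono (Finset.subset_univ _))] at hp₂B
  have hstR := hR.row_isStack hR1 (by linarith [hl s 1])
  have hRA : ∀ B ∈ R, B = A := fun B hB => by
    by_contra hne
    have h1 := hx0 A hA
    have h2 := hx0 B hB
    rcases hstR.le_or_le (fun t => hl t 0) hB hA hne with h3 | h3
    · linarith [hl B 0]
    · linarith [hl A 0]
  obtain ⟨u, huR⟩ : ∃ u, u ∉ R := by
    by_contra! hall
    exact hst ((hRA s (hall s)).trans (hRA t (hall t)).symm)
  -- The next row contains a tile `B` as wide as `A`, also at the left end, so `B` follows `A`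
  -- vertically and can be exchanged with it.
  obtain ⟨p₂, hp₂, R₂, hR₂S, -, hR₂η, hR₂, -⟩ :=
    hSR.exists_bottom_row hl hfree (t₀ := u) (by simp [huR])
  obtain rfl := hstuck _ (hp₂.mono (Finset.subset_univ _))
  have hR₂1 : ∀ t ∈ R₂, l t 1 = y0 + l s 1 + l u 1 - (y0 + l s 1) := fun t ht => by
    rw [hR₂η t ht]; ring
  have hst₂ := hR₂.row_isStack hR₂1 (by linarith [hl u 1])
  have hx : x0 ≤ x1 := by linarith [hstR.lo_le A hA, hstR.le_hi A hA, hl A 0]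
  obtain ⟨ψ, hψ⟩ := hfree 0 A
  obtain ⟨B, hB, hBA⟩ := hstR.exists_len_eq hψ hst₂ hx (fun t => hl t 0) hA
  obtain ⟨p₃, hp₃, hp₃B⟩ := exists_reach_front hl hR₂ hR₂1 hB
  rw [hstuck _ (hp₃.mono (Finset.subset_univ _))] at hp₃B
  refine hc _ ⟨1, A, Finset.mem_univ A, B, Finset.mem_univ B, ⟨?_, fun j hj => ?_⟩, rfl⟩
  · rw [hR₂.row_pos hR₂1 hB, hR.row_pos hR1 hA, hRη A hA]
  · obtain rfl : j = 0 := by omega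
    exact ⟨hp₃B.trans (hx0 A hA).symm, hBA⟩

end Matching

/-! ### Realizing exchanges by restricted shuffles -/

/-- The exchange of `[a, b)` and `[b, c)` on the real line. -/
noncomputable def rotate (a b c t : ℝ) : ℝ :=
  if a ≤ t ∧ t < b then t + (c - b) else if b ≤ t ∧ t < c then t - (b - a) else t

/-- The images of the two intervals meet at `a + c - b`, so the inverse is the exchange cut there.
-/
theorem rotate_rotate {a b c : ℝ} (hab : a < b) (hbc : b < c) (t : ℝ) :
    rotate a (a + c - b) c (rotate a b c t) = t := by
  unfold rotate
  by_cases h1 : a ≤ t ∧ t < b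
  · rw [if_pos h1, if_neg (by intro h; linarith [h.2]), if_pos ⟨by linarith, by linarith⟩]
    ring
  · rw [if_neg h1]
    by_cases h2 : b ≤ t ∧ t < c
    · rw [if_pos h2, if_pos ⟨by linarith, by linarith⟩]
      ring
    · rw [if_neg h2, if_neg, if_neg]
      · rintro ⟨h3, h4⟩
        rcases lt_or_ge t b with h5 | h5
        · exact h1 ⟨by linarith, h5⟩
        · exact h2 ⟨h5, h4⟩
      · rintro ⟨h3, h4⟩
        rcases lt_or_ge t b with h5 | h5
        · exact h1 ⟨h3, h5⟩
        · exact h2 ⟨h5, by linarith⟩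

theorem rotate_mem {a b c : ℝ} (ha : 0 ≤ a) (hab : a < b) (hbc : b < c) (hc : c ≤ 1) {t : ℝ}
    (ht : t ∈ Set.Ico (0 : ℝ) 1) : rotate a b c t ∈ Set.Ico (0 : ℝ) 1 := by
  unfold rotate
  split_ifs with h1 h2
  · exact ⟨by linarith [ht.1], by linarith [h1.2]⟩
  · exact ⟨by linarith [h2.1], by linarith [ht.2]⟩
  · exact ht

/-- The exchange of `[a, b)` and `[b, c)` as a permutation of `[0, 1)`. -/
noncomputable def rotation {a b c : ℝ} (ha : 0 ≤ a) (hab : a < b) (hbc : b < c) (hc : c ≤ 1) :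
    Equiv.Perm UnitIco where
  toFun t := ⟨rotate a b c t, rotate_mem ha hab hbc hc t.2⟩
  invFun t := ⟨rotate a (a + c - b) c t, rotate_mem ha (by linarith) (by linarith) hc t.2⟩
  left_inv t := Subtype.ext (rotate_rotate hab hbc t)
  right_inv t := Subtype.ext (by
    have h := rotate_rotate (a := a) (b := a + c - b) (c := c) (by linarith) (by linarith) t
    rwa [show a + c - (a + c - b) = b by ring] at h)

theorem isRestrictedRotation_rotation {a b c : ℝ} (ha : 0 ≤ a) (hab : a < b) (hbc : b < c)
    (hc : c ≤ 1) : IsRestrictedRotation (rotation ha hab hbc hc) a b c := by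
  refine ⟨ha, hab, hbc, hc, fun t => ⟨fun h1 h2 => ?_, fun h1 h2 => ?_, fun h => ?_⟩⟩
  · exact if_pos ⟨h1, h2⟩
  · exact (if_neg (by intro h; linarith [h.2])).trans (if_pos ⟨h1, h2⟩)
  · refine Subtype.ext ((if_neg ?_).trans (if_neg ?_)) <;> rintro ⟨h1, h2⟩ <;>
      rcases h with h | h <;> linarith

section Realize

variable {ι : Type} [DecidableEq ι]

theorem prPerp_update (i : ι) (x : Cube ι) (v : UnitIco) :
    prPerp i (Function.update x i v) = prPerp i x :=
  funext fun j => Function.update_of_ne j.2 _ _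

open Classical in
/-- The transformation `σ_{R,s,i}`. -/
noncomputable def rotationOver (i : ι) (R : Set (Cube {j : ι // j ≠ i})) (s : Equiv.Perm UnitIco) :
    Equiv.Perm (Cube ι) where
  toFun x := if prPerp i x ∈ R then Function.update x i (s (x i)) else x
  invFun x := if prPerp i x ∈ R then Function.update x i (s.symm (x i)) else x
  left_inv x := by
    by_cases h : prPerp i x ∈ R <;> simp [h, prPerp_update]
  right_inv x := by
    by_cases h : prPerp i x ∈ R <;> simp [h, prPerp_update]

theorem actsByRotationOver_rotationOver (i : ι) (R : Set (Cube {j : ι // j ≠ i}))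
    (s : Equiv.Perm UnitIco) : ActsByRotationOver i R s (rotationOver i R s) := by
  refine fun x => ⟨fun h => if_neg h, fun h => ?_⟩
  have e : rotationOver i R s x = Function.update x i (s (x i)) := if_pos h
  rw [e]
  exact ⟨fun j hj => Function.update_of_ne hj _ _, Function.update_self _ _ _⟩

variable {T : Type} {l p p' q : T → ι → ℝ}

/-- The subset of the cube occupied by the tile `t`. -/
def tileSet (l p : T → ι → ℝ) (t : T) : Set (Cube ι) :=
  {x | ∀ i, p t i ≤ (x i : ℝ) ∧ (x i : ℝ) < p t i + l t i}

theorem Follows.exists_shuffle [Fintype T] (hl : ∀ t i, 0 < l t i)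
    (h : Tiles l p Finset.univ (fun _ => 0) fun _ => 1) {i : ι} {s t : T}
    (hF : Follows l p i s t) :
    ∃ σ : Equiv.Perm (Cube ι), Shuffles σ (tileSet l p s) (tileSet l p t) ∧
      ∀ u, ∀ x ∈ tileSet l p u, ∀ j, (σ x j : ℝ) = x j + (exchange l p i s t u j - p u j) := by
  have hne := hF.ne hl
  have ha : 0 ≤ p s i := h.lo_le s (Finset.mem_univ s) i
  have hab : p s i < p s i + l s i := by linarith [hl s i]
  have hbc : p s i + l s i < p s i + l s i + l t i := by linarith [hl t i]
  have hc : p s i + l s i + l t i ≤ 1 := by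
    rw [← hF.1]; exact h.le_hi t (Finset.mem_univ t) i
  set R : Set (Cube {j : ι // j ≠ i}) :=
    {z | ∀ j : {j : ι // j ≠ i}, p s j ≤ (z j : ℝ) ∧ (z j : ℝ) < p s j + l s j} with hR
  have hs : tileSet l p s = {x | prPerp i x ∈ R ∧ p s i ≤ (x i : ℝ) ∧ (x i : ℝ) < p s i + l s i} := by
    ext x
    refine ⟨fun hx => ⟨fun j => hx j, hx i⟩, fun hx j => ?_⟩
    by_cases hj : j = i
    · subst hj; exact hx.2
    · exact hx.1 ⟨j, hj⟩
  have ht : tileSet l p t = {x | prPerp i x ∈ R ∧ p s i + l s i ≤ (x i : ℝ) ∧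
      (x i : ℝ) < p s i + l s i + l t i} := by
    ext x
    refine ⟨fun hx => ⟨fun j => ?_, ?_⟩, fun hx j => ?_⟩
    · rw [← (hF.2 j j.2).1, ← (hF.2 j j.2).2]; exact hx j
    · rw [← hF.1]; exact hx i
    · by_cases hj : j = i
      · subst hj; rw [hF.1]; exact hx.2
      · rw [(hF.2 j hj).1, (hF.2 j hj).2]; exact hx.1 ⟨j, hj⟩
  have hrot := isRestrictedRotation_rotation ha hab hbc hc
  have hact := actsByRotationOver_rotationOver i R (rotation ha hab hbc hc)
  refine ⟨rotationOver i R (rotation ha hab hbc hc), ⟨i, R, rotation ha hab hbc hc, p s i,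
    p s i + l s i, p s i + l s i + l t i, ⟨fun j => p s j, fun j => p s j + l s j, fun j =>
      ⟨h.lo_le s (Finset.mem_univ s) j, by linarith [hl s j],
        h.le_hi s (Finset.mem_univ s) j⟩, rfl⟩, hrot, hact, hs, ht⟩, fun u x hx j => ?_⟩
  by_cases hus : u = s
  · subst hus
    have hx' := hs ▸ hx
    by_cases hj : j = i
    · subst hj
      rw [((hact x).2 hx'.1).2, (hrot.2.2.2.2 (x j)).1 hx'.2.1 hx'.2.2, exchange_left]
      ring
    · rw [((hact x).2 hx'.1).1 j hj, exchange_of_ne_dir hj]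
      ring
  by_cases hut : u = t
  · subst hut
    have hx' := ht ▸ hx
    by_cases hj : j = i
    · subst hj
      rw [((hact x).2 hx'.1).2, (hrot.2.2.2.2 (x j)).2.1 hx'.2.1 hx'.2.2, exchange_right _ hne,
        hF.1]
      ring
    · rw [((hact x).2 hx'.1).1 j hj, exchange_of_ne_dir hj]
      ring
  rw [exchange_of_ne _ hus hut, sub_self, add_zero]
  by_cases hxR : prPerp i x ∈ R
  · by_cases hj : j = i
    · subst hj
      rw [((hact x).2 hxR).2, (hrot.2.2.2.2 (x j)).2.2]
      -- The box over `R` between the outer ends is the union of `s` and `t`, which the tile `u`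
      -- avoids.
      by_contra! hcon
      rcases lt_or_ge (x j : ℝ) (p s j + l s j) with h1 | h1
      · have hxs : x ∈ tileSet l p s := by rw [hs]; exact ⟨hxR, hcon.1, h1⟩
        exact hus (h.unique u (Finset.mem_univ u) s (Finset.mem_univ s) _ hx hxs)
      · have hxt : x ∈ tileSet l p t := by rw [ht]; exact ⟨hxR, h1, hcon.2⟩
        exact hut (h.unique u (Finset.mem_univ u) t (Finset.mem_univ t) _ hx hxt)
    · rw [((hact x).2 hxR).1 j hj]
  · rw [(hact x).1 hxR]

variable [Fintype T]

theorem Tiles.exists_mem_tileSet (h : Tiles l p Finset.univ (fun _ => 0) fun _ => 1)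
    (x : Cube ι) : ∃ t, x ∈ tileSet l p t := by
  obtain ⟨t, -, ht⟩ := h.exists_mem (fun i => x i) fun i => (x i).2
  exact ⟨t, ht⟩

/-- Each tile is mapped into its new place; equality follows because the old tiles cover the cube
and the new ones are disjoint. -/
theorem Tiles.image_tileSet (h : Tiles l p Finset.univ (fun _ => 0) fun _ => 1)
    (h' : Tiles l p' Finset.univ (fun _ => 0) fun _ => 1) {σ : Equiv.Perm (Cube ι)}
    (hσ : ∀ u, ∀ x ∈ tileSet l p u, ∀ j, (σ x j : ℝ) = x j + (p' u j - p u j)) (u : T) :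
    σ '' tileSet l p u = tileSet l p' u := by
  have key : ∀ v, ∀ x ∈ tileSet l p v, σ x ∈ tileSet l p' v := fun v x hx j => by
    rw [hσ v x hx j]
    exact ⟨by linarith [(hx j).1], by linarith [(hx j).2]⟩
  ext y
  constructor
  · rintro ⟨x, hx, rfl⟩
    exact key u x hx
  · intro hy
    obtain ⟨x, rfl⟩ := σ.surjective y
    obtain ⟨v, hv⟩ := h.exists_mem_tileSet x
    have hvu := h'.unique v (Finset.mem_univ v) u (Finset.mem_univ u) _ (key v x hv) hy
    exact ⟨x, hvu ▸ hv, rfl⟩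

/-- The list `rs` is a sequence of restricted shuffles on the tiling `p` whose composition moves
the tiles to the positions `q`. -/
def Realizes (l p q : T → ι → ℝ) (rs : List (Equiv.Perm (Cube ι))) : Prop :=
  IsShuffleSequence (Set.range (tileSet l p)) rs ∧
    ∀ u, ∀ x ∈ tileSet l p u, ∀ j, (composeSequence rs x j : ℝ) = x j + (q u j - p u j)

theorem Step.exists_realizes_cons (hl : ∀ t i, 0 < l t i)
    (h : Tiles l p Finset.univ (fun _ => 0) fun _ => 1) (hs : Step l Finset.univ p p')
    {rs : List (Equiv.Perm (Cube ι))} (hrs : Realizes l p' q rs) :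
    ∃ r, Realizes l p q (r :: rs) := by
  have h' := h.step hl hs
  obtain ⟨i, s, -, t, -, hF, rfl⟩ := hs
  obtain ⟨σ, hσ, hmove⟩ := hF.exists_shuffle hl h
  have himg := h.image_tileSet h' hmove
  refine ⟨σ, ⟨⟨_, ⟨s, rfl⟩, _, ⟨t, rfl⟩, hσ⟩, ?_⟩, fun u x hx j => ?_⟩
  · have e : imagePartition σ (Set.range (tileSet l p)) =
        Set.range (tileSet l (exchange l p i s t)) := by
      unfold imagePartition
      rw [← Set.range_comp]
      exact congrArg Set.range (funext himg)
    rw [e]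
    exact hrs.1
  · have hx' : σ x ∈ tileSet l (exchange l p i s t) u := himg u ▸ Set.mem_image_of_mem σ hx
    have e : composeSequence (σ :: rs) x = composeSequence rs (σ x) := rfl
    rw [e, hrs.2 u _ hx' j, hmove u x hx j]
    ring

theorem Reach.exists_realizes (hl : ∀ t i, 0 < l t i)
    (h : Tiles l p Finset.univ (fun _ => 0) fun _ => 1) (hs : Reach l Finset.univ p q) :
    ∃ rs, Realizes l p q rs := by
  induction hs using Relation.ReflTransGen.head_induction_on with
  | refl => exact ⟨[], trivial, fun u x _ j => by simp [composeSequence]⟩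
  | head hs _ ih =>
    obtain ⟨rs, hrs⟩ := ih (h.step hl hs)
    obtain ⟨r, hr⟩ := hs.exists_realizes_cons hl h hrs
    exact ⟨_, hr⟩

end Realize

/-! ### The tilings given by a partition and its image -/

theorem sideLength_eq {ι : Type} {K : Set (Cube ι)} {a b : ι → ℝ}
    (hab : ∀ i, 0 ≤ a i ∧ a i < b i ∧ b i ≤ 1)
    (hK : K = {x | ∀ i, a i ≤ (x i : ℝ) ∧ (x i : ℝ) < b i}) (i : ι) :
    sideLength i K = b i - a i := by
  classical
  have e : (fun x : Cube ι => (x i : ℝ)) '' K = Set.Ico (a i) (b i) := by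
    ext y
    constructor
    · rintro ⟨x, hx, rfl⟩
      rw [hK] at hx
      exact hx i
    · intro hy
      refine ⟨Function.update (fun j => ⟨a j, (hab j).1, by linarith [hab j]⟩) i
        ⟨y, (hab i).1.trans hy.1, hy.2.trans_le (hab i).2.2⟩, ?_, by simp⟩
      rw [hK]
      intro j
      by_cases hj : j = i
      · subst hj; simpa using hy
      · simpa [hj] using (hab j).2.1
  rw [sideLength, e, Real.volume_real_Ico, max_eq_left (by linarith [hab i])]

/-- The set extends to a basis of `ℝ` over `ℚ`, and `φ` is the coordinate at `v`. -/
theorem exists_coord_of_linearIndepOn {s : Set ℝ} (hs : LinearIndepOn ℚ (id : ℝ → ℝ) s) {v : ℝ}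
    (hv : v ∈ s) : ∃ φ : ℝ →+ ℝ, ∀ w ∈ s, φ w = if w = v then 1 else 0 := by
  have hsub := hs.subset_extend (Set.subset_univ s)
  refine ⟨((Rat.castHom ℝ) : ℚ →+ ℝ).comp
    ((Module.Basis.extend hs).coord ⟨v, hsub hv⟩).toAddMonoidHom, fun w hw => ?_⟩
  have h1 : (Module.Basis.extend hs).repr w = Finsupp.single ⟨w, hsub hw⟩ 1 := by
    have := (Module.Basis.extend hs).repr_self ⟨w, hsub hw⟩
    rwa [Module.Basis.extend_apply_self] at this
  simp [h1, Finsupp.single_apply, apply_ite]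

section Partition

variable {T : Type} [Fintype T] {ι : Type} {l p : T → ι → ℝ}

theorem Tiles.map_perm (h : Tiles l p Finset.univ (fun _ => 0) fun _ => 1)
    (hl : ∀ t i, 0 < l t i) (f : Equiv.Perm (Cube ι)) {v : T → ι → ℝ}
    (hv : ∀ t, ∀ x ∈ tileSet l p t, ∀ i, (f x i : ℝ) = (x i : ℝ) + v t i) :
    Tiles l (fun t i => p t i + v t i) Finset.univ (fun _ => 0) fun _ => 1 := by
  classical
  have hlo : ∀ t i, 0 ≤ p t i := fun t i => h.lo_le t (Finset.mem_univ t) i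
  have hhi : ∀ t i, p t i + l t i ≤ 1 := fun t i => h.le_hi t (Finset.mem_univ t) i
  have hpt : ∀ t (z : ι → ℝ), (∀ i, p t i ≤ z i ∧ z i < p t i + l t i) →
      ∃ x ∈ tileSet l p t, ∀ i, (x i : ℝ) = z i := fun t z hz =>
    ⟨fun i => ⟨z i, (hlo t i).trans (hz i).1, (hz i).2.trans_le (hhi t i)⟩, hz, fun _ => rfl⟩
  have hlo' : ∀ t i, 0 ≤ p t i + v t i := by
    intro t i
    obtain ⟨x, hx, hxz⟩ := hpt t (p t) fun i => ⟨le_rfl, by linarith [hl t i]⟩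
    rw [← hxz i, ← hv t x hx i]
    exact (f x i).2.1
  have hhi' : ∀ t i, p t i + v t i + l t i ≤ 1 := by
    intro t i
    by_contra! hc
    -- If the moved tile passed 1 in direction `i`, this point would lie in the tile and `f` would
    -- send its `i`-th coordinate to at least 1.
    obtain ⟨x, hx, hxz⟩ := hpt t (Function.update (p t) i (max (p t i) (1 - v t i))) fun j => by
      by_cases hj : j = i
      · subst hj
        rw [Function.update_self]
        exact ⟨le_max_left _ _, max_lt (by linarith [hl t j]) (by linarith)⟩
      · rw [Function.update_of_ne hj]
        exact ⟨le_rfl, by linarith [hl t j]⟩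
    have h1 := hv t x hx i
    rw [hxz i, Function.update_self] at h1
    linarith [(f x i).2.2, le_max_right (p t i) (1 - v t i)]
  refine ⟨fun t _ i => hlo' t i, fun t _ i => hhi' t i, fun z hz => ?_,
    fun t _ s _ z ht hs => ?_⟩
  · obtain ⟨x, hx⟩ := f.surjective fun i => ⟨z i, hz i⟩
    obtain ⟨t, ht⟩ := h.exists_mem_tileSet x
    refine ⟨t, Finset.mem_univ t, fun i => ?_⟩
    have h1 := hv t x ht i
    rw [hx] at h1
    simp only at h1
    rw [h1]
    exact ⟨by linarith [(ht i).1], by linarith [(ht i).2]⟩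
  · have key : ∀ r, Covers l (fun t i => p t i + v t i) r z →
        ∃ x ∈ tileSet l p r, ∀ i, (f x i : ℝ) = z i := by
      intro r hr
      obtain ⟨x, hx, hxz⟩ := hpt r (fun i => z i - v r i) fun i =>
        ⟨by linarith [(hr i).1], by linarith [(hr i).2]⟩
      exact ⟨x, hx, fun i => by rw [hv r x hx i, hxz i]; ring⟩
    obtain ⟨x, hx, hxz⟩ := key t ht
    obtain ⟨y, hy, hyz⟩ := key s hs
    have hxy : x = y := f.injective (funext fun i => Subtype.ext ((hxz i).trans (hyz i).symm))
    exact h.unique t (Finset.mem_univ t) s (Finset.mem_univ s) _ hx (hxy ▸ hy)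

end Partition

/-- A rectangle partition is the tiling by its members. -/
theorem IsRectanglePartition.exists_tiles {ι : Type} {P : Set (Set (Cube ι))} [Fintype P]
    (hP : IsRectanglePartition P) : ∃ l p : P → ι → ℝ, (∀ t i, 0 < l t i) ∧
      (∀ (t : P) i, sideLength i (t : Set (Cube ι)) = l t i) ∧
      (∀ t : P, tileSet l p t = (t : Set (Cube ι))) ∧
      Tiles l p Finset.univ (fun _ => 0) fun _ => 1 := by
  obtain ⟨-, hpart, hrect⟩ := hP
  choose a b hab hK using fun t : P => hrect t t.2
  have hset : ∀ t : P, tileSet (fun t i => b t i - a t i) a t = (t : Set (Cube ι)) := by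
    intro t
    rw [hK t]
    simp [tileSet]
  refine ⟨fun t i => b t i - a t i, a, fun t i => by linarith [hab t i],
    fun t i => sideLength_eq (hab t) (hK t) i, hset, fun t _ i => (hab t i).1,
    fun t _ i => by linarith [(hab t i).2.2], fun q hq => ?_, fun t _ s _ q ht hs => ?_⟩
  · obtain ⟨K, ⟨hKP, hxK⟩, -⟩ := hpart.2 fun i => ⟨q i, hq i⟩
    refine ⟨⟨K, hKP⟩, Finset.mem_univ _, ?_⟩
    have : (fun i => ⟨q i, hq i⟩ : Cube ι) ∈ tileSet (fun t i => b t i - a t i) a ⟨K, hKP⟩ := by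
      rw [hset]; exact hxK
    exact this
  · have hq : ∀ i, q i ∈ Set.Ico (0 : ℝ) 1 := fun i =>
      ⟨(hab t i).1.trans (ht i).1, by linarith [(ht i).2, (hab t i).2.2]⟩
    have ht' : (fun i => ⟨q i, hq i⟩ : Cube ι) ∈ (t : Set (Cube ι)) := by
      rw [← hset]; exact ht
    have hs' : (fun i => ⟨q i, hq i⟩ : Cube ι) ∈ (s : Set (Cube ι)) := by
      rw [← hset]; exact hs
    exact Subtype.ext ((hpart.2 _).unique ⟨t.2, ht'⟩ ⟨s.2, hs'⟩)

theorem IsRectanglePartition.exists_ne {ι : Type} {P : Set (Set (Cube ι))}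
    (hP : IsRectanglePartition P) (hne : P ≠ {Set.univ}) : ∃ s t : P, s ≠ t := by
  by_contra! hall
  obtain ⟨-, hpart, -⟩ := hP
  obtain ⟨K, ⟨hK, -⟩, -⟩ := hpart.2 fun _ => ⟨0, le_rfl, one_pos⟩
  have hKL : ∀ L ∈ P, L = K := fun L hL => congrArg Subtype.val (hall ⟨L, hL⟩ ⟨K, hK⟩)
  have hKu : K = Set.univ := Set.eq_univ_of_forall fun x => by
    obtain ⟨L, ⟨hL, hx⟩, -⟩ := hpart.2 x
    exact hKL L hL ▸ hx
  exact hne (Set.eq_singleton_iff_unique_mem.2 ⟨hKu ▸ hK, fun L hL => (hKL L hL).trans hKu⟩)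

end RectExchange

/-! ### The theorem, with the pieces of `P` as labels -/

theorem mainTheorem9
    (f : Equiv.Perm (RectExchange.Cube (Fin 2))) (hf : f ∈ RectExchange.Rec 2)
    (P : Set (Set (RectExchange.Cube (Fin 2))))
    (hP : P ∈ RectExchange.associatedPartitions f)
    (hfree : RectExchange.SetwiseQFree P) :
    ∃ rs : List (Equiv.Perm (RectExchange.Cube (Fin 2))),
      RectExchange.IsShuffleSequence P rs ∧
      f = RectExchange.composeSequence rs ∧
      (P ≠ {Set.univ} → rs ≠ []) := by
  classical
  obtain ⟨hpart, htrans⟩ := hP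
  have : Fintype P := hpart.1.fintype
  obtain ⟨l, p, hl, hside, hset, htiles⟩ := hpart.exists_tiles
  have hF : RectExchange.Free l := by
    intro i t₀
    obtain ⟨φ, hφ⟩ := RectExchange.exists_coord_of_linearIndepOn (hfree i)
      (Set.mem_image_of_mem _ t₀.2)
    refine ⟨φ, fun t => ?_⟩
    rw [← hside t i, ← hside t₀ i]
    exact hφ _ (Set.mem_image_of_mem _ t.2)
  choose v hv using fun t : P => htrans t t.2
  have hv' : ∀ t, ∀ x ∈ RectExchange.tileSet l p t, ∀ i, (f x i : ℝ) = (x i : ℝ) + v t i :=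
    fun t x hx => hv t x (hset t ▸ hx)
  have htiles' := htiles.map_perm hl f hv'
  have hrange : Set.range (RectExchange.tileSet l p) = P := by
    rw [funext hset]
    exact Subtype.range_coe
  have e0 : (fun _ => 0 : Fin 2 → ℝ) = ![0, 0] := by ext j; fin_cases j <;> rfl
  have e1 : (fun _ => 1 : Fin 2 → ℝ) = ![1, 1] := by ext j; fin_cases j <;> rfl
  have hreach : ∀ r, RectExchange.Tiles l r Finset.univ (fun _ => 0) (fun _ => 1) →
      RectExchange.Reach l Finset.univ r (fun t i => p t i + v t i) := by
    intro r hr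
    rw [e0, e1] at hr htiles'
    exact hr.reach_tiles hl hF htiles'
  obtain ⟨rs, hrs, hne⟩ : ∃ rs, RectExchange.Realizes l p (fun t i => p t i + v t i) rs ∧
      (P ≠ {Set.univ} → rs ≠ []) := by
    by_cases hPu : P = {Set.univ}
    · obtain ⟨rs, hrs⟩ := (hreach p htiles).exists_realizes hl htiles
      exact ⟨rs, hrs, fun h => (h hPu).elim⟩
    · obtain ⟨s, t, hst⟩ := hpart.exists_ne hPu
      -- An arbitrary first exchange makes the sequence non-empty, even when `f` is the identity;
      -- the target remains reachable from the resulting tiling.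
      obtain ⟨p', hp'⟩ := (e0 ▸ e1 ▸ htiles).exists_step hl hF hst
      have h' := htiles.step hl hp'
      obtain ⟨rs, hrs⟩ := (hreach p' h').exists_realizes hl h'
      obtain ⟨r, hr⟩ := hp'.exists_realizes_cons hl htiles hrs
      exact ⟨_, hr, fun _ => List.cons_ne_nil _ _⟩
  refine ⟨rs, hrange ▸ hrs.1, Equiv.ext fun x => funext fun j => Subtype.ext ?_, hne⟩
  obtain ⟨t, ht⟩ := htiles.exists_mem_tileSet x
  rw [hrs.2 t x ht j, hv' t x ht j]
  ring
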